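/- **Preliminaries.** A *Batanin tree* is a tree $\mathrm{br}[B_1,\dots,B_m]$ for a finite (possibly empty) list of Batanin trees; its dimension $\dim$ is its height. Its positions form a globular set $\mathrm{Pos}(B)$: every tree has a $0$-position $\mathrm{here}$; for $B'=\mathrm{br}[B,B_1,\dots,B_m]$ and $L=[B_1,\dots,B_m]$, every $k$-position $p$ of $\mathrm{br}\,L$ gives a $k$-position $\mathrm{inr}\,p$ of $B'$, and every $k$-position $q$ of $B$ gives a $(k+1)$-position $\mathrm{inl}\,q$ of $B'$. Sources and targets are given by $\mathrm{src}(\mathrm{inr}\,p)=\mathrm{inr}(\mathrm{src}\,p)$ and $\mathrm{tgt}(\mathrm{inr}\,p)=\mathrm{inr}(\mathrm{tgt}\,p)$; for a $0$-position $q$, $\mathrm{src}(\mathrm{inl}\,q)=\mathrm{here}$ and $\mathrm{tgt}(\mathrm{inl}\,q)=\mathrm{inr}(\mathrm{here})$; in higher dimensions, $\mathrm{src}(\mathrm{inl}\,q)=\mathrm{inl}(\mathrm{src}\,q)$ and $\mathrm{tgt}(\mathrm{inl}\,q)=\mathrm{inl}(\mathrm{tgt}\,q)$. A position is *source boundary*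 (resp. *target boundary*) if it is not the target (resp. source) of a position. **Computads.** A $0$-computad is a set, homomorphisms are functions, the $0$-cells are the elements, $0$-spheres are pairs of elements, the free $0$-computad on a globular set $X$ is $X_0$, and a $0$-sphere $(a,b)$ of the free computad on $\mathrm{Pos}(B)$ is *full* if $a$ is source boundary and $b$ is target boundary. By convention there is exactly one $(-1)$-sphere. For $n\ge 1$, recursively: * An *$n$-computad* is $C=(C_{n-1},V_n^C,\phi_n^C)$ with $C_{n-1}$ an $(n-1)$-computad, $V_n^C$ a set of generators and $\phi_n^C:V_n^C\to\mathrm{Type}_{n-1}(C_{n-1})$ a function into the set of $(n-1)$-spheres of $C_{n-1}$. The free $n$-computad $\mathrm{Free}_nX$ on a globular set $X$ has underlying $(n-1)$-computad $\mathrm{Free}_{n-1}X$, generators $X_n$, and sends $x$ to the $(n-1)$-sphere of $\mathrm{Free}_{n-1}X$ determined by $(\mathrm{src}\,x,\mathrm{tgt}\,x)$. * The set $\mathrm{Cell}_n(C)$ and the homomorphisms into $C$ are defined by mutual induction. Cells are $\mathrm{var}\,v$ for $v\in V^C_n$, with boundary $\phi_n^C(v)$, and $\mathrm{coh}(B,A,\tau)$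 for a Batanin tree $B$ with $\dim B\le n$, a full $(n-1)$-sphere $A$ of $\mathrm{Free}_{n-1}\mathrm{Pos}(B)$ and a homomorphism $\tau:\mathrm{Free}_n\mathrm{Pos}(B)\to C$, with boundary $\tau_{n-1}(A)$. A homomorphism $\sigma:D\to C$ is a pair of a homomorphism $\sigma_{n-1}:D_{n-1}\to C_{n-1}$ and a function $\sigma_V:V_n^D\to\mathrm{Cell}_n(C)$ such that the boundary of $\sigma_V(v)$ is $\sigma_{n-1}(\phi_n^D(v))$. It acts on cells by $\mathrm{var}\,v\mapsto\sigma_V(v)$ and $\mathrm{coh}(B,A,\tau)\mapsto\mathrm{coh}(B,A,\sigma\circ\tau)$, where $\sigma\circ\tau$ consists of $\sigma_{n-1}\circ\tau_{n-1}$ and of $\tau_V$ followed by the action of $\sigma$. * An *$n$-sphere* of $C$ is $(A,a,b)$ with $A$ an $(n-1)$-sphere of $C_{n-1}$ and $a,b\in\mathrm{Cell}_n(C)$ with boundary $A$. For parallel $x,y\in X_n$ the corresponding $n$-sphere of $\mathrm{Free}_nX$ consists of the sphere determined by their common source and target, together with $\mathrm{var}\,x$ and $\mathrm{var}\,y$.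 The support of $\mathrm{var}\,v$ is $\{v\}$ and that of $\mathrm{coh}(B,A,\tau)$ is the union of the supports of $\tau_V(p)$ over the $n$-positions $p$ of $B$. An $n$-sphere $(A,a,b)$ of $\mathrm{Free}_n\mathrm{Pos}(B)$ is *full* if $A$ is full, the support of $a$ is the set of source boundary $n$-positions and the support of $b$ is the set of target boundary $n$-positions. The category of $\omega$-computads is the limit of the categories of $n$-computads along the forgetful functors $C\mapsto C_{n-1}$. A homomorphism is *generator-preserving* if, in every dimension $k\geq 1$, it sends each generator to a cell $\mathrm{var}\,w$ (no condition in dimension $0$). For $n\in\mathbb N\cup\{\omega\}$, let $\mathrm{Comp}_n^{\mathrm{var}}$ be the category of $n$-computads and generator-preserving homomorphisms. It has a terminal object $\top_n$, with one $0$-dimensional generator and, for each finite $j$ with $1\le j\le n$, exactly one $j$-dimensional generator with boundary $A_0$ for each $(j-1)$-sphere $A_0$ of the terminal computad. Let $\mathfrak T_k$ be the set of $k$-spheres of the terminal computad, for $k\ge-1$; for $A_0\in\mathfrak T_k$ write $\mathrm{var}\,A_0$ for the $(k+1)$-cell of the terminal computad given by the corresponding generator (for $k=-1$, the unique $0$-cell).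 **Theorem.** Let $n\in\mathbb N\cup\{\omega\}$. For every finite $k$ with $-1\le k<n$ and every $A_0\in\mathfrak T_k$, the functor $\mathrm{Comp}_n^{\mathrm{var}}\to\mathrm{Set}$ sending $C$ to the set of $(k+1)$-cells of $C$ whose image under the unique generator-preserving homomorphism $C\to\top_n$ is $\mathrm{var}\,A_0$ is represented by an $n$-computad $J_n^{\mathfrak C}(\mathrm{var}\,A_0)$. Moreover, if $\mathcal V_n$ denotes the full subcategory of $\mathrm{Comp}_n^{\mathrm{var}}$ on the $n$-computads $J_n^{\mathfrak C}(\mathrm{var}\,A_0)$, for $-1\le k<n$ and $A_0\in\mathfrak T_k$, then $\mathrm{Comp}_n^{\mathrm{var}}$ is equivalent to the category of presheaves of sets on $\mathcal V_n$. -/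

import Mathlib

open CategoryTheory

universe u

namespace Computads

/-! ### Globular sets, Batanin trees and their positions -/

/-- A globular set: sets of `n`-cells with source and target maps satisfying globularity. -/
structure GlobSet where
  cells : ℕ → Type u
  src : ∀ {n : ℕ}, cells (n + 1) → cells n
  tgt : ∀ {n : ℕ}, cells (n + 1) → cells n
  src_src : ∀ {n : ℕ} (x : cells (n + 2)), src (src x) = src (tgt x)
  tgt_src : ∀ {n : ℕ} (x : cells (n + 2)), tgt (src x) = tgt (tgt x)

/-- Two `n`-cells have common source and target (no condition when `n = 0`). -/
def GlobSet.Parallel (X : GlobSet.{u}) : ∀ n : ℕ, X.cells n → X.cells n → Prop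
  | 0, _, _ => True
  | _ + 1, x, y => X.src x = X.src y ∧ X.tgt x = X.tgt y

theorem GlobSet.parallel_src_tgt (X : GlobSet.{u}) :
    ∀ (n : ℕ) (x : X.cells (n + 1)), X.Parallel n (X.src x) (X.tgt x)
  | 0, _ => trivial
  | _ + 1, x => ⟨X.src_src x, X.tgt_src x⟩

/-- Batanin trees: finite rooted planar trees. -/
inductive Bat : Type
  | br : List Bat → Bat

mutual
/-- The dimension (height) of a Batanin tree. -/
def Bat.dim : Bat → ℕ
  | .br L => Bat.dimList L
/-- The dimension of the tree `br L`. -/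
def Bat.dimList : List Bat → ℕ
  | [] => 0
  | B :: L => max (Bat.dim B + 1) (Bat.dimList L)
end

/-- `Pos B n` is the set of `n`-dimensional positions of the tree `B`
(placed in an arbitrary universe). -/
inductive Pos : Bat → ℕ → Type u
  | here (B : Bat) : Pos B 0
  | inr {B : Bat} {L : List Bat} {n : ℕ} (p : Pos (.br L) n) : Pos (.br (B :: L)) n
  | inl {B : Bat} {L : List Bat} {n : ℕ} (q : Pos B n) : Pos (.br (B :: L)) (n + 1)

/-- The source of a position. -/
def Pos.src : ∀ {B : Bat} {n : ℕ}, Pos.{u} B (n + 1) → Pos.{u} B n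
  | _, _, .inr p => .inr p.src
  | _, 0, .inl _ => .here _
  | _, _ + 1, .inl q => .inl q.src

/-- The target of a position. -/
def Pos.tgt : ∀ {B : Bat} {n : ℕ}, Pos.{u} B (n + 1) → Pos.{u} B n
  | _, _, .inr p => .inr p.tgt
  | _, 0, .inl _ => .inr (.here _)
  | _, _ + 1, .inl q => .inl q.tgt

theorem Pos.src_src : ∀ {B : Bat} {n : ℕ} (p : Pos.{u} B (n + 2)), p.src.src = p.tgt.src
  | _, _, .inr p => by simp only [Pos.src, Pos.tgt, Pos.src_src p]
  | _, 0, .inl _ => by simp only [Pos.src, Pos.tgt]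
  | _, _ + 1, .inl q => by simp only [Pos.src, Pos.tgt, Pos.src_src q]

theorem Pos.tgt_src : ∀ {B : Bat} {n : ℕ} (p : Pos.{u} B (n + 2)), p.src.tgt = p.tgt.tgt
  | _, _, .inr p => by simp only [Pos.src, Pos.tgt, Pos.tgt_src p]
  | _, 0, .inl _ => by simp only [Pos.src, Pos.tgt]
  | _, _ + 1, .inl q => by simp only [Pos.src, Pos.tgt, Pos.tgt_src q]

/-- The globular set of positions of a Batanin tree. -/
def Bat.pos (B : Bat) : GlobSet.{u} where
  cells := Pos B
  src := Pos.src
  tgt := Pos.tgt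
  src_src := Pos.src_src
  tgt_src := Pos.tgt_src

/-- Source boundary positions: those that are not the target of another position. -/
def Pos.IsSrcBoundary {B : Bat} {n : ℕ} (p : Pos.{u} B n) : Prop :=
  ¬ ∃ q : Pos.{u} B (n + 1), q.tgt = p

/-- Target boundary positions: those that are not the source of another position. -/
def Pos.IsTgtBoundary {B : Bat} {n : ℕ} (p : Pos.{u} B n) : Prop :=
  ¬ ∃ q : Pos.{u} B (n + 1), q.src = p

/-! ### The recursion defining `n`-computads

`Stage n` records the data in dimension `n` on which dimension `n + 1` depends. It only serves as
the type of the recursion: the objects of interest are the values `stage n` defined below. -/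

/-- The data produced by the recursion in dimension `n`: the category of `n`-computads, the functor
of `n`-spheres, the free `n`-computad on a globular set, the `n`-sphere of the free computad given
by two parallel `n`-cells of the globular set, and the full `n`-spheres of a Batanin tree. -/
structure Stage (n : ℕ) where
  Obj : Type (u + 1)
  [cat : Category.{u} Obj]
  Sph : Obj ⥤ Type u
  free : GlobSet.{u} → Obj
  posSph : ∀ (X : GlobSet.{u}) (x y : X.cells n), X.Parallel n x y → Sph.obj (free X)
  Full : ∀ B : Bat, Sph.obj (free B.pos) → Prop

attribute [instance] Stage.cat

/-- Dimension `0`: a `0`-computad is a set, whose elements are its `0`-cells, and a `0`-sphere is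
a pair of elements. -/
def Stage.zero : Stage.{u} 0 where
  Obj := Type u
  Sph :=
    { obj := fun C => C × C
      map := fun f => TypeCat.ofHom fun x => (f x.1, f x.2) }
  free X := X.cells 0
  posSph _ x y _ := (x, y)
  Full _ A := Pos.IsSrcBoundary A.1 ∧ Pos.IsTgtBoundary A.2

section Step

variable {n : ℕ} {S : Stage.{u} n}

/-- An `(n+1)`-computad: an `n`-computad, a set of generators, and a sphere for each of them. -/
structure Computad (S : Stage.{u} n) where
  base : S.Obj
  Gen : Type u
  bdry : Gen → S.Sph.obj base

/-- The free `(n+1)`-computad on a globular set. -/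
def Computad.free (S : Stage.{u} n) (X : GlobSet.{u}) : Computad S where
  base := S.free X
  Gen := X.cells (n + 1)
  bdry x := S.posSph X (X.src x) (X.tgt x) (X.parallel_src_tgt n x)

/-- Raw `(n+1)`-cells: generators and coherence cells `coh (B, A, (τ, τV))`, in which the condition
that `(τ, τV)` is a homomorphism is not yet imposed. -/
inductive PreCell (C : Computad S) : Type u
  | var (v : C.Gen) : PreCell C
  | coh (B : Bat) (hB : B.dim ≤ n + 1) (A : S.Sph.obj (S.free B.pos)) (hA : S.Full B A)
      (τ : S.free B.pos ⟶ C.base) (τV : Pos.{u} B (n + 1) → PreCell C) : PreCell C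

/-- The boundary sphere of a cell. -/
def PreCell.bdry {C : Computad S} : PreCell C → S.Sph.obj C.base
  | .var v => C.bdry v
  | .coh _ _ A _ τ _ => S.Sph.map τ A

/-- The raw cells in which every `(τ, τV)` is, hereditarily, a homomorphism out of the free
computad on the positions of the tree. -/
def PreCell.IsCell {C : Computad S} : PreCell C → Prop
  | .var _ => True
  | .coh B _ _ _ τ τV => ∀ p : Pos.{u} B (n + 1),
      (τV p).IsCell ∧ (τV p).bdry = S.Sph.map τ ((Computad.free S B.pos).bdry p)

/-- The set of generators of top dimension occurring in a cell. -/
def PreCell.support {C : Computad S} : PreCell C → Set C.Gen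
  | .var v => {v}
  | .coh _ _ _ _ _ τV => ⋃ p, (τV p).support

/-- The `(n+1)`-cells of an `(n+1)`-computad. -/
def Cell (C : Computad S) : Type u := {c : PreCell C // c.IsCell}

/-- The generator `v`, as a cell. -/
def Cell.var {C : Computad S} (v : C.Gen) : Cell C := ⟨.var v, trivial⟩

/-- The boundary sphere of a cell. -/
def Cell.bdry {C : Computad S} (c : Cell C) : S.Sph.obj C.base := c.1.bdry

/-- Homomorphisms of `(n+1)`-computads. -/
@[ext]
structure Hom (D C : Computad S) where
  base : D.base ⟶ C.base
  onGen : D.Gen → Cell C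
  comm : ∀ v : D.Gen, (onGen v).bdry = S.Sph.map base (D.bdry v)

/-- The coherence cell of a tree `B` of dimension at most `n + 1`, a full `n`-sphere `A` and a
homomorphism out of the free computad on `B`. -/
def Cell.coh {C : Computad S} (B : Bat) (hB : B.dim ≤ n + 1) (A : S.Sph.obj (S.free B.pos))
    (hA : S.Full B A) (τ : Hom (Computad.free S B.pos) C) : Cell C :=
  ⟨.coh B hB A hA τ.base fun p => (τ.onGen p).1, fun p => ⟨(τ.onGen p).2, τ.comm p⟩⟩

/-- The action of a homomorphism on raw cells: it substitutes cells for generators. -/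
def PreCell.map {C D : Computad S} (σ : Hom C D) : PreCell C → PreCell D
  | .var v => (σ.onGen v).1
  | .coh B hB A hA τ τV => .coh B hB A hA (τ ≫ σ.base) fun p => (τV p).map σ

theorem PreCell.bdry_map {C D : Computad S} (σ : Hom C D) (c : PreCell C) :
    (c.map σ).bdry = S.Sph.map σ.base c.bdry := by
  cases c with
  | var v => exact σ.comm v
  | coh B hB A hA τ τV => simp [PreCell.map, PreCell.bdry]

theorem PreCell.isCell_map {C D : Computad S} (σ : Hom C D) (c : PreCell C) (hc : c.IsCell) :
    (c.map σ).IsCell := by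
  induction c with
  | var v => exact (σ.onGen v).2
  | coh B hB A hA τ τV ih =>
    intro p
    refine ⟨ih p (hc p).1, ?_⟩
    rw [PreCell.bdry_map, (hc p).2]
    exact (congrArg (fun f => f ((Computad.free S B.pos).bdry p))
      (S.Sph.map_comp τ σ.base)).symm

/-- The identity homomorphism. -/
def Hom.id (C : Computad S) : Hom C C where
  base := 𝟙 C.base
  onGen := Cell.var
  comm v := by simp [Cell.bdry, Cell.var, PreCell.bdry]

/-- The action of a homomorphism on cells. -/
def Cell.map {C D : Computad S} (σ : Hom C D) (c : Cell C) : Cell D :=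
  ⟨c.1.map σ, PreCell.isCell_map σ c.1 c.2⟩

theorem Cell.bdry_map {C D : Computad S} (σ : Hom C D) (c : Cell C) :
    (c.map σ).bdry = S.Sph.map σ.base c.bdry :=
  PreCell.bdry_map σ c.1

/-- Composition of homomorphisms. -/
def Hom.comp {C D E : Computad S} (σ : Hom C D) (ρ : Hom D E) : Hom C E where
  base := σ.base ≫ ρ.base
  onGen v := (σ.onGen v).map ρ
  comm v := by rw [Cell.bdry_map, σ.comm v]; simp

theorem PreCell.map_id {C : Computad S} (c : PreCell C) : c.map (Hom.id C) = c := by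
  induction c with
  | var v => rfl
  | coh B hB A hA τ τV ih => simp only [PreCell.map, ih]; simp [Hom.id]

theorem PreCell.map_comp {C D E : Computad S} (σ : Hom C D) (ρ : Hom D E) (c : PreCell C) :
    c.map (σ.comp ρ) = (c.map σ).map ρ := by
  induction c with
  | var v => rfl
  | coh B hB A hA τ τV ih => simp only [PreCell.map, ih]; simp [Hom.comp]

theorem Cell.map_id {C : Computad S} (c : Cell C) : c.map (Hom.id C) = c :=
  Subtype.ext (PreCell.map_id c.1)

theorem Cell.map_comp {C D E : Computad S} (σ : Hom C D) (ρ : Hom D E) (c : Cell C) :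
    c.map (σ.comp ρ) = (c.map σ).map ρ :=
  Subtype.ext (PreCell.map_comp σ ρ c.1)

/-- The category of `(n+1)`-computads. -/
instance : Category.{u} (Computad S) where
  Hom := Hom
  id := Hom.id
  comp := Hom.comp
  id_comp σ := Hom.ext (Category.id_comp σ.base) rfl
  comp_id σ := Hom.ext (Category.comp_id σ.base) (funext fun v => Cell.map_id (σ.onGen v))
  assoc σ ρ π := Hom.ext (Category.assoc σ.base ρ.base π.base)
    (funext fun v => (Cell.map_comp ρ π (σ.onGen v)).symm)

/-- The functor forgetting the generators of dimension `n + 1`. -/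
def forget (S : Stage.{u} n) : Computad S ⥤ S.Obj where
  obj C := C.base
  map σ := Hom.base σ

/-- The functor of `(n+1)`-cells. -/
def cellFunctor (S : Stage.{u} n) : Computad S ⥤ Type u where
  obj C := Cell C
  map σ := TypeCat.ofHom (Cell.map σ)
  map_id C := by ext c; exact Cell.map_id c
  map_comp σ ρ := by ext c; exact Cell.map_comp σ ρ c

/-- An `(n+1)`-sphere: an `n`-sphere and two `(n+1)`-cells with that boundary. -/
@[ext]
structure Sphere (C : Computad S) where
  base : S.Sph.obj C.base
  fst : Cell C
  snd : Cell C
  fst_bdry : fst.bdry = base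
  snd_bdry : snd.bdry = base

/-- The action of a homomorphism on spheres. -/
def Sphere.map {C D : Computad S} (σ : Hom C D) (A : Sphere C) : Sphere D where
  base := S.Sph.map σ.base A.base
  fst := A.fst.map σ
  snd := A.snd.map σ
  fst_bdry := by rw [Cell.bdry_map, A.fst_bdry]
  snd_bdry := by rw [Cell.bdry_map, A.snd_bdry]

/-- The functor of `(n+1)`-spheres. -/
def sphereFunctor (S : Stage.{u} n) : Computad S ⥤ Type u where
  obj C := Sphere C
  map σ := TypeCat.ofHom (Sphere.map σ)
  map_id C := by
    ext A
    · exact congrArg (fun f => f A.base) (S.Sph.map_id C.base)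
    · exact Cell.map_id A.fst
    · exact Cell.map_id A.snd
  map_comp σ ρ := by
    ext A
    · exact congrArg (fun f => f A.base) (S.Sph.map_comp (Hom.base σ) (Hom.base ρ))
    · exact Cell.map_comp σ ρ A.fst
    · exact Cell.map_comp σ ρ A.snd

/-- The inductive step of the recursion. -/
def Stage.succ (S : Stage.{u} n) : Stage.{u} (n + 1) where
  Obj := Computad S
  Sph := sphereFunctor S
  free := Computad.free S
  posSph X x y h :=
    { base := S.posSph X (X.src x) (X.tgt x) (X.parallel_src_tgt n x)
      fst := Cell.var (C := Computad.free S X) x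
      snd := Cell.var (C := Computad.free S X) y
      fst_bdry := rfl
      snd_bdry := by
        obtain ⟨h₁, h₂⟩ := h
        simp only [Cell.bdry, Cell.var, PreCell.bdry, Computad.free, h₁, h₂] }
  Full B A := A.fst.1.support = {p : Pos.{u} B (n + 1) | p.IsSrcBoundary} ∧
    A.snd.1.support = {p : Pos.{u} B (n + 1) | p.IsTgtBoundary} ∧ S.Full B A.base

end Step

/-! ### The categories of computads -/

/-- The recursion defining computads in every finite dimension. -/
def stage : ∀ n : ℕ, Stage.{u} n
  | 0 => Stage.zero
  | n + 1 => (stage n).succ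

/-- The type of `n`-computads. -/
abbrev Comp (n : ℕ) : Type (u + 1) := (stage.{u} n).Obj

/-- The functor of `n`-spheres of an `n`-computad. -/
abbrev sph (n : ℕ) : Comp.{u} n ⥤ Type u := (stage.{u} n).Sph

/-- The functor of `n`-cells of an `n`-computad. -/
def cell : ∀ n : ℕ, Comp.{u} n ⥤ Type u
  | 0 => 𝟭 (Type u)
  | n + 1 => cellFunctor (stage.{u} n)

/-- The forgetful functor from `(n+1)`-computads to `n`-computads. -/
def down (n : ℕ) : Comp.{u} (n + 1) ⥤ Comp.{u} n := forget (stage.{u} n)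

/-- Generator-preserving homomorphisms of `n`-computads. -/
def genPres : ∀ n : ℕ, MorphismProperty (Comp.{u} n)
  | 0 => fun _ _ _ => True
  | n + 1 => fun (C D : Computad (stage.{u} n)) (σ : Hom C D) =>
      genPres n σ.base ∧ ∀ v : C.Gen, ∃ w : D.Gen, σ.onGen v = Cell.var w

theorem genPres_id : ∀ (n : ℕ) (C : Comp.{u} n), genPres n (𝟙 C)
  | 0, _ => trivial
  | n + 1, C => ⟨genPres_id n (Computad.base C), fun v => ⟨v, rfl⟩⟩

theorem genPres_comp : ∀ (n : ℕ) {C D E : Comp.{u} n} (σ : C ⟶ D) (ρ : D ⟶ E),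
    genPres n σ → genPres n ρ → genPres n (σ ≫ ρ)
  | 0, _, _, _, _, _, _, _ => trivial
  | n + 1, _, _, _, σ, ρ, hσ, hρ => by
    refine ⟨genPres_comp n (Hom.base σ) (Hom.base ρ) hσ.1 hρ.1, fun v => ?_⟩
    obtain ⟨w, hw⟩ := hσ.2 v
    obtain ⟨z, hz⟩ := hρ.2 w
    refine ⟨z, ?_⟩
    change Cell.map ρ (Hom.onGen σ v) = _
    rw [hw, ← hz]
    rfl

instance (n : ℕ) : (genPres.{u} n).IsMultiplicative where
  id_mem C := genPres_id n C
  comp_mem σ ρ hσ hρ := genPres_comp n σ ρ hσ hρ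

/-- The category of `n`-computads and generator-preserving homomorphisms. -/
abbrev CompVar (n : ℕ) : Type (u + 1) := WideSubcategory (genPres.{u} n)

/-- The forgetful functor restricted to generator-preserving homomorphisms. -/
def downVar (n : ℕ) : CompVar.{u} (n + 1) ⥤ CompVar.{u} n where
  obj C := ⟨(down n).obj C.obj⟩
  map σ := ⟨(down n).map σ.hom, σ.property.1⟩

/-- The composite of the forgetful functors from dimension `n` down to dimension `k ≤ n`. -/
def truncVar {k n : ℕ} (h : k ≤ n) : CompVar.{u} n ⥤ CompVar.{u} k :=
  Nat.leRecOn (C := fun m => CompVar.{u} m ⥤ CompVar.{u} k) h (fun {m} F => downVar m ⋙ F)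
    (𝟭 (CompVar.{u} k))

/-- An `ω`-computad: an object of the limit of the tower of categories of `n`-computads. -/
structure CompOmega where
  obj : ∀ n : ℕ, Comp.{u} n
  down_obj : ∀ n : ℕ, (down n).obj (obj (n + 1)) = obj n

/-- A morphism in the limit of the tower of categories of `n`-computads. -/
@[ext]
structure CompOmega.Hom (C D : CompOmega.{u}) where
  app : ∀ n : ℕ, C.obj n ⟶ D.obj n
  down_app : ∀ n : ℕ, (down n).map (app (n + 1)) =
    eqToHom (C.down_obj n) ≫ app n ≫ eqToHom (D.down_obj n).symm

instance : Category.{u} CompOmega.{u} where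
  Hom := CompOmega.Hom
  id C := ⟨fun n => 𝟙 (C.obj n), fun n => by simp⟩
  comp σ ρ := ⟨fun n => σ.app n ≫ ρ.app n, fun n => by
    rw [Functor.map_comp, σ.down_app, ρ.down_app]; simp⟩
  id_comp σ := CompOmega.Hom.ext (funext fun n => Category.id_comp (σ.app n))
  comp_id σ := CompOmega.Hom.ext (funext fun n => Category.comp_id (σ.app n))
  assoc σ ρ π := CompOmega.Hom.ext
    (funext fun n => Category.assoc (σ.app n) (ρ.app n) (π.app n))

/-- Generator-preserving homomorphisms of `ω`-computads. -/
def genPresOmega : MorphismProperty CompOmega.{u} :=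
  fun _ _ σ => ∀ n : ℕ, genPres n (CompOmega.Hom.app σ n)

instance : genPresOmega.{u}.IsMultiplicative where
  id_mem C n := genPres_id n (C.obj n)
  comp_mem σ ρ hσ hρ n :=
    genPres_comp n (CompOmega.Hom.app σ n) (CompOmega.Hom.app ρ n) (hσ n) (hρ n)

/-- The category of `ω`-computads and generator-preserving homomorphisms. -/
abbrev CompVarOmega : Type (u + 1) := WideSubcategory genPresOmega.{u}

/-- The forgetful functor from `ω`-computads to `k`-computads. -/
def truncVarOmega (k : ℕ) : CompVarOmega.{u} ⥤ CompVar.{u} k where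
  obj C := ⟨C.obj.obj k⟩
  map σ := ⟨CompOmega.Hom.app σ.hom k, σ.property k⟩

/-! ### The terminal computads and the shape of a cell -/

/-- The terminal `n`-computad: one `0`-dimensional generator and, in each dimension `k + 1 ≤ n`, one
generator for every `k`-sphere, having that sphere as its boundary. -/
def top : ∀ n : ℕ, Comp.{u} n
  | 0 => (PUnit.{u + 1} : Type u)
  | n + 1 => ({ base := top n, Gen := (sph n).obj (top n), bdry := fun A => A } :
      Computad (stage.{u} n))

/-- The generator-preserving homomorphism to the terminal `n`-computad. -/
def bang : ∀ (n : ℕ) (C : Comp.{u} n), C ⟶ top n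
  | 0, _ => TypeCat.ofHom fun _ => PUnit.unit
  | n + 1, C => ({
      base := bang n (Computad.base C)
      onGen := fun v => Cell.var (C := (top (n + 1) : Computad (stage.{u} n)))
        ((sph n).map (bang n (Computad.base C)) (Computad.bdry C v))
      comm := fun _ => rfl } :
      Hom (S := stage.{u} n) C (top (n + 1)))

theorem genPres_bang : ∀ (n : ℕ) (C : Comp.{u} n), genPres n (bang n C)
  | 0, _ => trivial
  | n + 1, C => ⟨genPres_bang n (Computad.base C), fun _ => ⟨_, rfl⟩⟩

theorem eq_bang : ∀ (n : ℕ) {C : Comp.{u} n} (σ : C ⟶ top n), genPres n σ → σ = bang n C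
  | 0, _, _, _ => TypeCat.homEquiv.injective (funext fun _ => rfl)
  | n + 1, C, σ, hσ => by
    have hb := eq_bang n (Hom.base σ) hσ.1
    refine Hom.ext hb (funext fun v => ?_)
    obtain ⟨w, hw⟩ := hσ.2 v
    have hc := Hom.comm σ v
    rw [hw] at hc
    change w = (sph n).map (Hom.base σ) (Computad.bdry C v) at hc
    change Hom.onGen σ v = Cell.var ((sph n).map (bang n (Computad.base C)) (Computad.bdry C v))
    rw [hw, hc, hb]
    rfl

/-- The functor sending a `k`-computad `C` to the set of its `k`-cells of shape `c₀`, where `c₀` is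
a `k`-cell of the terminal `k`-computad. -/
def cellOfShape (k : ℕ) (c₀ : (cell.{u} k).obj (top k)) : CompVar.{u} k ⥤ Type u where
  obj C := {c : (cell k).obj C.obj // (cell k).map (bang k C.obj) c = c₀}
  map {C D} σ := TypeCat.ofHom fun c => ⟨(cell k).map σ.hom c.1, by
    have h := eq_bang k (σ.hom ≫ bang k D.obj)
      (genPres_comp k _ _ σ.property (genPres_bang k D.obj))
    have h' := congrArg (fun f => f c.1) ((cell k).map_comp σ.hom (bang k D.obj))
    rw [h] at h'
    exact h'.symm.trans c.2⟩
  map_id C := by ext c; exact congrArg (fun f => f c.1) ((cell k).map_id C.obj)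
  map_comp σ ρ := by ext c; exact congrArg (fun f => f c.1) ((cell k).map_comp σ.hom ρ.hom)

/-- `TopSphere j` is the set of spheres of dimension `j - 1` of the terminal computad; there is
exactly one sphere of dimension `-1`. -/
def TopSphere : ℕ → Type u
  | 0 => PUnit
  | j + 1 => (sph j).obj (top j)

/-- The `j`-dimensional generator of the terminal computad given by a `(j-1)`-sphere, as a cell. -/
def varTop : ∀ j : ℕ, TopSphere.{u} j → (cell.{u} j).obj (top j)
  | 0, A₀ => A₀
  | j + 1, A₀ => Cell.var (C := (top (j + 1) : Computad (stage.{u} j))) A₀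

/-! ### Representing computads and the index categories -/

/-- A chosen object corepresenting `F` (an arbitrary object if there is none). -/
noncomputable def reprObj {E : Type (u + 1)} [Category.{u} E] [Nonempty E] (F : E ⥤ Type u) : E :=
  Classical.epsilon fun X => Nonempty (F.CorepresentableBy X)

instance (n : ℕ) : Nonempty (CompVar.{u} n) := ⟨⟨top n⟩⟩

instance : Nonempty CompVarOmega.{u} := ⟨⟨⟨top, fun _ => rfl⟩⟩⟩

/-- The functor of `k`-cells of shape `c₀` of an `n`-computad, for `k ≤ n`. -/
def cellShape {k n : ℕ} (h : k ≤ n) (c₀ : (cell.{u} k).obj (top k)) : CompVar.{u} n ⥤ Type u :=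
  truncVar h ⋙ cellOfShape k c₀

/-- The functor of `k`-cells of shape `c₀` of an `ω`-computad. -/
def cellShapeOmega (k : ℕ) (c₀ : (cell.{u} k).obj (top k)) : CompVarOmega.{u} ⥤ Type u :=
  truncVarOmega k ⋙ cellOfShape k c₀

/-- The `n`-computad representing the functor of `k`-cells of shape `c₀`. -/
noncomputable def J {k n : ℕ} (h : k ≤ n) (c₀ : (cell.{u} k).obj (top k)) : CompVar.{u} n :=
  reprObj (cellShape h c₀)

/-- The `ω`-computad representing the functor of `k`-cells of shape `c₀`. -/
noncomputable def JOmega (k : ℕ) (c₀ : (cell.{u} k).obj (top k)) : CompVarOmega.{u} :=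
  reprObj (cellShapeOmega k c₀)

/-- The full subcategory on the `n`-computads `J (var A₀)`, where `A₀` is a sphere of the terminal
computad of dimension `j - 1` with `0 ≤ j ≤ n`. -/
abbrev V (n : ℕ) : Type (u + 1) :=
  (ObjectProperty.ofObj fun i : (Σ j : Fin (n + 1), TopSphere.{u} j) =>
    J (Nat.le_of_lt_succ i.1.2) (varTop i.1 i.2)).FullSubcategory

/-- The full subcategory on the `ω`-computads `J (var A₀)`, where `A₀` is a sphere of the terminal
computad of any finite dimension `j - 1` with `0 ≤ j`. -/
abbrev VOmega : Type (u + 1) :=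
  (ObjectProperty.ofObj fun i : (Σ j : ℕ, TopSphere.{u} j) =>
    JOmega i.1 (varTop i.1 i.2)).FullSubcategory

end Computads

namespace Computads

open Limits Opposite

-- Universal elements and limits of corepresentable functors

section Corepresentability

universe v w

-- A cocomplete category is a presheaf category as soon as it has a small family of objects such
-- that mapping out of each preserves colimits and these functors jointly reflect isomorphisms
-- (`nonempty_equivalence_presheaf`). Here the functors are the cells of generator shape.
-- Generator-preserving homomorphisms respect the distinction between generators and coherence
-- cells, so in positive dimension a cell over `var A₀` is a generator with boundary of shape `A₀`.
-- An `(n+1)`-computad is a set over the spheres of an `n`-computad (`toComma`). Hence colimits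
-- exist and taking generators preserves them, and a map bijective on generators of every shape is
-- invertible, dimension by dimension.
--
-- The harder half is corepresentability, which is proved for more functors than needed: spheres,
-- cells and homomorphisms out of a fixed computad, each with prescribed image in the terminal
-- computad (`familial_sph_coyoneda`, `familial_cell`). A homomorphism is its lower part together
-- with cells having prescribed boundaries, a sphere is two cells with a common boundary, and a
-- coherence cell of given shape is a homomorphism of given shape. The first two are pullbacks, and
-- pullbacks of corepresentable functors are corepresented by pushouts
-- (`isCorepresentable_of_pullback`). The induction is on dimension and, inside a dimension, on the
-- cell of the terminal computad.
--
-- For `ω`, colimits are formed levelwise. They give a tower commuting only up to isomorphism, which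
-- is then made strict (`exists_truncVarOmega_obj_iso`). Corepresenting objects in dimension `k` are
-- extended by empty sets of generators.

theorem isCorepresentable_of_existsUnique {E : Type w} [Category.{v} E] {F : E ⥤ Type v} (R : E)
    (r : F.obj R) (h : ∀ (D : E) (y : F.obj D), ∃! f : R ⟶ D, F.map f r = y) :
    F.IsCorepresentable :=
  Functor.CorepresentableBy.isCorepresentable (X := R)
    { homEquiv := fun {D} => Equiv.ofBijective (fun f : R ⟶ D => F.map f r)
        ((Function.bijective_iff_existsUnique _).2 (h D))
      homEquiv_comp := fun g f => by simp }

theorem exists_universal_element {E : Type w} [Category.{v} E] (F : E ⥤ Type v)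
    [F.IsCorepresentable] :
    ∃ (R : E) (r : F.obj R), ∀ (D : E) (y : F.obj D), ∃! f : R ⟶ D, F.map f r = y := by
  refine ⟨F.coreprX, F.corepresentableBy.homEquiv (𝟙 _), fun D y => ?_⟩
  simp only [← F.corepresentableBy.homEquiv_eq]
  exact (Function.bijective_iff_existsUnique _).1 F.corepresentableBy.homEquiv.bijective y

/-- A functor which is a limit of corepresentable functors `A` and `B i` over corepresentable
functors `S i` is corepresentable. -/
theorem isCorepresentable_of_pullback {E : Type w} [Category.{v} E] [HasColimitsOfSize.{v, v} E]
    {I : Type v} {G A : E ⥤ Type v} {B S : I → E ⥤ Type v} (π : G ⟶ A) (ρ : ∀ i, G ⟶ B i)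
    (α : ∀ i, A ⟶ S i) (β : ∀ i, B i ⟶ S i)
    (hA : A.IsCorepresentable) (hB : ∀ i, (B i).IsCorepresentable)
    (hS : ∀ i, (S i).IsCorepresentable)
    (comm : ∀ i D (g : G.obj D), (α i).app D (π.app D g) = (β i).app D ((ρ i).app D g))
    (h : ∀ D (a : A.obj D) (b : ∀ i, (B i).obj D),
      (∀ i, (α i).app D a = (β i).app D (b i)) →
        ∃! g : G.obj D, π.app D g = a ∧ ∀ i, (ρ i).app D g = b i) :
    G.IsCorepresentable := by
  obtain ⟨X, x, hX⟩ := exists_universal_element A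
  choose Y y hY using fun i => exists_universal_element (B i)
  choose Z z hZ using fun i => exists_universal_element (S i)
  choose a ha _ using fun i => hZ i _ ((α i).app _ x)
  choose b hb _ using fun i => hZ i _ ((β i).app _ (y i))
  have hZ' : ∀ i D (f g : Z i ⟶ D), (S i).map f (z i) = (S i).map g (z i) → f = g :=
    fun i D f g e => (hZ i D _).unique e rfl
  -- The coequalizer of `c₁` and `c₂` is the wide pushout gluing each `Y i` to `X` along `Z i`; it
  -- will corepresent `G`.
  let c₁ : ∐ Z ⟶ X ⨿ ∐ Y := Sigma.desc fun i => a i ≫ coprod.inl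
  let c₂ : ∐ Z ⟶ X ⨿ ∐ Y := Sigma.desc fun i => b i ≫ Sigma.ι Y i ≫ coprod.inr
  let q : X ⨿ ∐ Y ⟶ coequalizer c₁ c₂ := coequalizer.π c₁ c₂
  let jX : X ⟶ coequalizer c₁ c₂ := coprod.inl ≫ q
  let jY : ∀ i, Y i ⟶ coequalizer c₁ c₂ := fun i => Sigma.ι Y i ≫ coprod.inr ≫ q
  have hj : ∀ i, a i ≫ jX = b i ≫ jY i := fun i => by
    have := congrArg (fun f => Sigma.ι Z i ≫ f) (coequalizer.condition c₁ c₂)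
    simpa [c₁, c₂, jX, jY, q] using this
  -- The universal element is glued from the images of the universal elements `x` and `y i`, which
  -- agree over `S i` by `hj`.
  obtain ⟨g, ⟨hg₁, hg₂⟩, -⟩ := h _ (A.map jX x) (fun i => (B i).map (jY i) (y i)) fun i => by
    rw [NatTrans.naturality_apply, NatTrans.naturality_apply, ← ha, ← hb,
      ← Functor.map_comp_apply, ← Functor.map_comp_apply, hj]
  refine isCorepresentable_of_existsUnique _ g fun D g' => ?_
  obtain ⟨fX, hfX, fX_uniq⟩ := hX D (π.app D g')
  choose fY hfY fY_uniq using fun i => hY i D ((ρ i).app D g')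
  have hf : ∀ i, a i ≫ fX = b i ≫ fY i := fun i => by
    apply hZ'
    rw [Functor.map_comp_apply, Functor.map_comp_apply, ha, hb, ← NatTrans.naturality_apply,
      ← NatTrans.naturality_apply, hfX, hfY, comm]
  have key : ∀ k : coequalizer c₁ c₂ ⟶ D, G.map k g = g' ↔ jX ≫ k = fX ∧ ∀ i, jY i ≫ k = fY i := by
    intro k
    constructor
    · rintro rfl
      refine ⟨fX_uniq _ ?_, fun i => fY_uniq _ _ ?_⟩
      · simp only [NatTrans.naturality_apply, Functor.map_comp_apply, hg₁]
      · simp only [NatTrans.naturality_apply, Functor.map_comp_apply, hg₂]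
    · rintro ⟨h₁, h₂⟩
      refine (h D (π.app D g') (fun i => (ρ i).app D g') fun i => comm i D g').unique
        ⟨?_, fun i => ?_⟩ ⟨rfl, fun _ => rfl⟩
      · rw [NatTrans.naturality_apply, hg₁, ← Functor.map_comp_apply, h₁, hfX]
      · rw [NatTrans.naturality_apply, hg₂, ← Functor.map_comp_apply, h₂, hfY]
  obtain ⟨d, hd₁, hd₂⟩ : ∃ d : X ⨿ ∐ Y ⟶ D, coprod.inl ≫ d = fX ∧
      ∀ i, Sigma.ι Y i ≫ coprod.inr ≫ d = fY i :=
    ⟨coprod.desc fX (Sigma.desc fY), coprod.inl_desc _ _, fun i => by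
      rw [coprod.inr_desc, Sigma.ι_desc]⟩
  refine ⟨coequalizer.desc d ?_, (key _).2 ⟨?_, fun i => ?_⟩, ?_⟩
  · refine Sigma.hom_ext _ _ fun i => ?_
    simp [c₁, c₂, hd₁, hd₂, hf]
  · simp [jX, q, hd₁]
  · simp [jY, q, hd₂]
  · intro k hk
    obtain ⟨h₁, h₂⟩ := (key k).1 hk
    refine coequalizer.hom_ext (coprod.hom_ext ?_ (Sigma.hom_ext _ _ fun i => ?_))
    · simpa [jX, q, hd₁] using h₁
    · simpa [jY, q, hd₂] using h₂ i

end Corepresentability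

-- Fibres over a constant functor

section Fibers

universe w

/-- The functor of elements lying over `x` for a map from `F` to a constant functor. -/
def fiberFunctor {E : Type w} [Category.{u} E] {F : E ⥤ Type u} {X : Type u}
    (t : ∀ C : E, F.obj C → X) (ht : ∀ {C D : E} (f : C ⟶ D) (a : F.obj C), t D (F.map f a) = t C a)
    (x : X) : E ⥤ Type u where
  obj C := {a : F.obj C // t C a = x}
  map f := TypeCat.ofHom fun a => ⟨F.map f a.1, (ht f a.1).trans a.2⟩

-- The functor `F` is the disjoint union of its fibres. To map out of one fibre of the colimit,
-- extend a cocone on that fibre to all of `F` with vertex `Option s.pt`, sending the other fibres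
-- to `none`. Every element of the colimit comes from some stage of the diagram, so on the chosen
-- fibre the induced map avoids `none`.
open Classical in
theorem preservesColimits_fiberFunctor {E : Type w} [Category.{u} E] {F : E ⥤ Type u} {X : Type u}
    (t : ∀ C : E, F.obj C → X) (ht : ∀ {C D : E} (f : C ⟶ D) (a : F.obj C), t D (F.map f a) = t C a)
    (x : X) [PreservesColimitsOfSize.{u, u} F] :
    PreservesColimitsOfSize.{u, u} (fiberFunctor t ht x) where
  preservesColimitsOfShape {K} _ := ⟨fun {G} => ⟨fun {c} hc => by
    have hF := isColimitOfPreserves F hc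
    have hsurj := Types.jointly_surjective _ hF
    let ext (s : Cocone (G ⋙ fiberFunctor t ht x)) : Cocone (G ⋙ F) :=
      { pt := Option s.pt
        ι :=
          { app := fun k => TypeCat.ofHom fun a : F.obj (G.obj k) =>
              if h : t _ a = x then some (s.ι.app k ⟨a, h⟩) else none
            naturality := fun k l f => by
              ext (a : F.obj (G.obj k))
              have e : t _ (F.map (G.map f) a) = t _ a := ht _ _
              by_cases h : t _ a = x
              · have := ConcreteCategory.congr_hom (s.w f) ⟨a, h⟩
                simp [h, e, ← this]
                rfl
              · simp [h, e] } }
    have hext (s) (k : K) (a : F.obj (G.obj k)) (h : t _ a = x) :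
        hF.desc (ext s) (F.map (c.ι.app k) a) = some (s.ι.app k ⟨a, h⟩) := by
      have := ConcreteCategory.congr_hom (hF.fac (ext s) k) a
      refine this.trans ?_
      simp [ext, h]
    have hsome (s) (p : (fiberFunctor t ht x).obj c.pt) : (hF.desc (ext s) p.1).isSome := by
      obtain ⟨k, a, ha⟩ := hsurj p.1
      have h : t _ a = x := (ht (c.ι.app k) a).symm.trans ((congrArg _ ha).trans p.2)
      have := hext s k a h
      rw [show F.map (c.ι.app k) a = p.1 from ha] at this
      simp [this]
    exact ⟨
      { desc := fun s => TypeCat.ofHom fun p => (hF.desc (ext s) p.1).get (hsome s p)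
        fac := fun s k => by
          ext ⟨a, h⟩
          exact Option.get_of_eq_some _ (hext s k a h)
        uniq := fun s m hm => by
          ext p
          obtain ⟨k, a, ha⟩ := hsurj p.1
          have h : t _ a = x := (ht (c.ι.app k) a).symm.trans ((congrArg _ ha).trans p.2)
          obtain rfl : p = (fiberFunctor t ht x).map (c.ι.app k) ⟨a, h⟩ := Subtype.ext ha.symm
          exact (ConcreteCategory.congr_hom (hm k) ⟨a, h⟩).trans
            (Option.get_of_eq_some _ (hext s k a h)).symm }⟩⟩⟩

end Fibers

-- Recognition of presheaf categories

section PresheafCategories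

/-- A natural transformation of colimit-preserving functors on a presheaf category is an isomorphism
when it is so on the representable presheaves. -/
theorem isIso_app_of_isIso_representable {C : Type u} [Category.{u} C] {E : Type*} [Category E]
    {F G : (Cᵒᵖ ⥤ Type u) ⥤ E} [PreservesColimitsOfSize.{u, u} F]
    [PreservesColimitsOfSize.{u, u} G] (τ : F ⟶ G)
    (h : ∀ X : C, IsIso (τ.app (uliftYoneda.{u}.obj X))) (P : Cᵒᵖ ⥤ Type u) : IsIso (τ.app P) := by
  -- Since `P` is a colimit of representables, `τ.app P` is the map of colimits induced by
  -- isomorphisms of diagrams.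
  let R := Presheaf.functorToRepresentables.{u} P
  let t := Presheaf.colimitOfRepresentable.{u} P
  have (x : P.Elementsᵒᵖ) : IsIso ((Functor.whiskerLeft R τ).app x) := h _
  have := NatIso.isIso_of_isIso_app (Functor.whiskerLeft R τ)
  have e : τ.app P = ((isColimitOfPreserves F t).coconePointsIsoOfNatIso (isColimitOfPreserves G t)
      (asIso (Functor.whiskerLeft R τ))).hom := by
    refine (isColimitOfPreserves F t).hom_ext fun x => ?_
    refine Eq.trans ?_ (IsColimit.comp_coconePointsIsoOfNatIso_hom (isColimitOfPreserves F t)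
      (isColimitOfPreserves G t) (asIso (Functor.whiskerLeft R τ)) x).symm
    exact τ.naturality _
  rw [e]
  exact Iso.isIso_hom _

/-- A cocomplete category with a small, jointly conservative family of objects such that mapping out
of each of them preserves colimits is a category of presheaves on these objects. -/
theorem nonempty_equivalence_presheaf {E : Type (u + 1)} [Category.{u} E]
    [HasColimitsOfSize.{u, u} E] {ι : Type u} (X : ι → E)
    (tiny : ∀ i, PreservesColimitsOfSize.{u, u} (coyoneda.obj (op (X i))))
    (conservative : ∀ {A B : E} (f : A ⟶ B),
      (∀ i, Function.Bijective fun g : X i ⟶ A => g ≫ f) → IsIso f) :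
    Nonempty (E ≌ ((ObjectProperty.ofObj X).FullSubcategoryᵒᵖ ⥤ Type u)) := by
  -- The objects are indexed by the small type `ι`, as the Kan extension requires. The full
  -- subcategory, whose objects live one universe higher, is only substituted at the end, along `I`.
  let A : InducedCategory E X ⥤ E := inducedFunctor X
  let N := Presheaf.restrictedULiftYoneda.{u} A
  let L : ((InducedCategory E X)ᵒᵖ ⥤ Type u) ⥤ E := uliftYoneda.{u}.leftKanExtension A
  let adj : L ⊣ N := Presheaf.uliftYonedaAdjunction.{u} L (uliftYoneda.{u}.leftKanExtensionUnit A)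
  have hN : PreservesColimitsOfSize.{u, u} N := by
    refine preservesColimits_of_evaluation N fun c => ?_
    have := tiny (unop c)
    exact preservesColimits_of_natIso (F := coyoneda.obj (op (X (unop c))) ⋙ uliftFunctor.{u})
      (Iso.refl _)
  have hL : PreservesColimitsOfSize.{u, u} L := adj.leftAdjoint_preservesColimits
  have hunit : ∀ P, IsIso (adj.unit.app P) := by
    refine isIso_app_of_isIso_representable (F := 𝟭 _) (G := L ⋙ N) adj.unit fun c => ?_
    have hα : IsIso ((uliftYoneda.{u}.leftKanExtensionUnit A).app c) := inferInstance
    refine (NatTrans.isIso_iff_isIso_app _).2 fun Z => (isIso_iff_bijective _).2 ?_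
    -- On a representable the unit is `A.map` followed by an isomorphism, hence bijective because
    -- `A` is fully faithful.
    have e : ∀ z, (adj.unit.app (uliftYoneda.{u}.obj c)).app Z z =
        ULift.up (A.map z.down ≫ (uliftYoneda.{u}.leftKanExtensionUnit A).app c) := fun z => by
      have := Presheaf.uliftYonedaAdjunction_unit_app_app.{u} L
        (uliftYoneda.{u}.leftKanExtensionUnit A) (uliftYoneda.{u}.obj c) z
      refine this.trans ?_
      obtain ⟨z⟩ := z
      have hz : uliftYonedaEquiv.{u}.symm (ULift.up z) = uliftYoneda.{u}.map z := by
        rw [← uliftYonedaEquiv_uliftYoneda_map, Equiv.symm_apply_apply]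
      refine congrArg ULift.up ?_
      refine (congrArg (fun f => _ ≫ L.map f) hz).trans ?_
      exact ((uliftYoneda.{u}.leftKanExtensionUnit A).naturality z).symm
    rw [funext e]
    exact (Equiv.ulift.trans ((fullyFaithfulInducedFunctor X).homEquiv.trans
      ((asIso ((uliftYoneda.{u}.leftKanExtensionUnit A).app c)).homToEquiv.trans
        Equiv.ulift.symm))).bijective
  have : IsIso adj.unit := NatIso.isIso_of_isIso_app _
  have hcounit : ∀ B, IsIso (adj.counit.app B) := fun B => by
    -- The triangle identity and the invertible unit make the nerve of the counit invertible. Its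
    -- components are composition on the sets of maps out of the `X i`, so `conservative` applies.
    have : IsIso (N.map (adj.counit.app B)) := by
      have := adj.right_triangle_components B
      exact IsIso.of_isIso_fac_left this
    refine conservative _ fun i => ?_
    have hi : IsIso ((N.map (adj.counit.app B)).app (op i)) := inferInstance
    exact (Equiv.ulift.symm.bijective.of_comp_iff' _).1
      (((isIso_iff_bijective _).1 hi).comp Equiv.ulift.symm.bijective)
  have : IsIso adj.counit := NatIso.isIso_of_isIso_app _
  let I : InducedCategory E X ⥤ (ObjectProperty.ofObj X).FullSubcategory :=
    ObjectProperty.lift _ A fun i => ⟨i⟩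
  have : I.EssSurj := ⟨by
    rintro ⟨_, ⟨i⟩⟩
    exact ⟨i, ⟨Iso.refl _⟩⟩⟩
  have : I.IsEquivalence := {}
  exact ⟨adj.toEquivalence.symm.trans I.asEquivalence.op.congrLeft⟩

end PresheafCategories

-- Colimits of `n`-computads

section Colimits

/-- The functor of spheres on generator-preserving homomorphisms. -/
def sphVar (n : ℕ) : CompVar.{u} n ⥤ Type u := wideSubcategoryInclusion _ ⋙ sph n

theorem Cell.var_injective {n : ℕ} {S : Stage.{u} n} {C : Computad S} :
    Function.Injective (Cell.var (C := C)) := fun _ _ h => PreCell.var.inj (congrArg Subtype.val h)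

/-- The action of a generator-preserving homomorphism on generators of top dimension. -/
noncomputable def genMap {n : ℕ} {C D : CompVar.{u} (n + 1)} (σ : C ⟶ D)
    (v : Computad.Gen (S := stage.{u} n) C.obj) : Computad.Gen (S := stage.{u} n) D.obj :=
  Classical.choose (σ.property.2 v)

theorem var_genMap {n : ℕ} {C D : CompVar.{u} (n + 1)} (σ : C ⟶ D)
    (v : Computad.Gen (S := stage.{u} n) C.obj) :
    Cell.var (genMap σ v) = Hom.onGen (S := stage.{u} n) σ.hom v :=
  (Classical.choose_spec (σ.property.2 v)).symm

theorem bdry_genMap {n : ℕ} {C D : CompVar.{u} (n + 1)} (σ : C ⟶ D)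
    (v : Computad.Gen (S := stage.{u} n) C.obj) :
    Computad.bdry (S := stage.{u} n) D.obj (genMap σ v) =
      (sphVar n).map ((downVar n).map σ) (Computad.bdry (S := stage.{u} n) C.obj v) :=
  (congrArg Cell.bdry (var_genMap σ v)).trans (Hom.comm (S := stage.{u} n) σ.hom v)

/-- The functor of generators of top dimension. -/
noncomputable def genVar (n : ℕ) : CompVar.{u} (n + 1) ⥤ Type u where
  obj C := Computad.Gen (S := stage.{u} n) C.obj
  map σ := TypeCat.ofHom (genMap σ)
  map_id C := by
    ext v
    exact Cell.var_injective (var_genMap (𝟙 C) v)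
  map_comp {C D E} σ ρ := by
    ext v
    refine Cell.var_injective ((var_genMap (σ ≫ ρ) v).trans ?_)
    refine Eq.trans ?_ (var_genMap ρ (genMap σ v)).symm
    change Cell.map (S := stage.{u} n) ρ.hom (Hom.onGen (S := stage.{u} n) σ.hom v) = _
    rw [← var_genMap]
    rfl

/-- The generator-preserving homomorphism given by a homomorphism in the lower dimensions and a map
of generators compatible with their boundaries. -/
def homMk {n : ℕ} {C D : CompVar.{u} (n + 1)} (σ : (downVar n).obj C ⟶ (downVar n).obj D)
    (f : Computad.Gen (S := stage.{u} n) C.obj → Computad.Gen (S := stage.{u} n) D.obj)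
    (h : ∀ v, Computad.bdry (S := stage.{u} n) D.obj (f v) =
      (sphVar n).map σ (Computad.bdry (S := stage.{u} n) C.obj v)) : C ⟶ D :=
  ⟨({ base := σ.hom, onGen := fun v => Cell.var (f v), comm := h } :
      Hom (S := stage.{u} n) C.obj D.obj), σ.property, fun v => ⟨f v, rfl⟩⟩

theorem genMap_homMk {n : ℕ} {C D : CompVar.{u} (n + 1)}
    (σ : (downVar n).obj C ⟶ (downVar n).obj D)
    (f : Computad.Gen (S := stage.{u} n) C.obj → Computad.Gen (S := stage.{u} n) D.obj)
    (h) : genMap (homMk σ f h) = f :=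
  funext fun v => Cell.var_injective (var_genMap (homMk σ f h) v)

theorem compVar_hom_ext {n : ℕ} {C D : CompVar.{u} (n + 1)} {σ ρ : C ⟶ D}
    (h : (downVar n).map σ = (downVar n).map ρ) (h' : genMap σ = genMap ρ) : σ = ρ := by
  refine WideSubcategory.hom_ext _ (Hom.ext (S := stage.{u} n) ?_ (funext fun v => ?_))
  · exact congrArg InducedWideCategory.Hom.hom h
  · exact (var_genMap σ v).symm.trans ((congrArg Cell.var (congrFun h' v)).trans (var_genMap ρ v))

/-- An `(n+1)`-computad is a set mapping to the spheres of an `n`-computad. -/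
noncomputable def toComma (n : ℕ) : CompVar.{u} (n + 1) ⥤ Comma (𝟭 (Type u)) (sphVar.{u} n) where
  obj C :=
    { left := (genVar n).obj C
      right := (downVar n).obj C
      hom := TypeCat.ofHom (Computad.bdry (S := stage.{u} n) C.obj) }
  map σ :=
    { left := (genVar n).map σ
      right := (downVar n).map σ
      w := by ext v; exact bdry_genMap σ v }

instance (n : ℕ) : (toComma.{u} n).Faithful where
  map_injective h := compVar_hom_ext (congrArg CommaMorphism.right h)
    (congrArg (fun f => (f.left : _ → _)) h)

instance (n : ℕ) : (toComma.{u} n).Full where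
  map_surjective {C D} f := by
    refine ⟨homMk f.right f.left fun v => ?_, ?_⟩
    · exact ConcreteCategory.congr_hom f.w v
    · refine CommaMorphism.ext ?_ rfl
      ext v
      exact congrFun (genMap_homMk _ _ _) v

instance (n : ℕ) : (toComma.{u} n).EssSurj where
  mem_essImage X := ⟨⟨({ base := X.right.obj, Gen := X.left, bdry := X.hom } :
    Computad (stage.{u} n))⟩, ⟨Iso.refl _⟩⟩

instance (n : ℕ) : (toComma.{u} n).IsEquivalence where

instance : (wideSubcategoryInclusion (genPres.{u} 0)).IsEquivalence where
  full := ⟨fun f => ⟨⟨f, trivial⟩, rfl⟩⟩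
  essSurj := ⟨fun X => ⟨⟨X⟩, ⟨Iso.refl _⟩⟩⟩

/-- Colimits in the comma category only require its left functor, the identity of `Type u`, to
preserve them. Nothing is asked of the sphere functor. -/
instance hasColimits_compVar : ∀ n : ℕ, HasColimitsOfSize.{u, u} (CompVar.{u} n)
  | 0 => by
    have : HasColimitsOfSize.{u, u} (Comp.{u} 0) := inferInstanceAs (HasColimits (Type u))
    exact Adjunction.has_colimits_of_equivalence (wideSubcategoryInclusion (genPres.{u} 0))
  | n + 1 => by
    have := hasColimits_compVar n
    exact Adjunction.has_colimits_of_equivalence (toComma.{u} n)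

instance (n : ℕ) : PreservesColimitsOfSize.{u, u} (downVar.{u} n) :=
  have : PreservesColimitsOfSize.{u, u} (Comma.snd (𝟭 (Type u)) (sphVar.{u} n)) := ⟨inferInstance⟩
  inferInstanceAs (PreservesColimitsOfSize.{u, u} (toComma n ⋙ Comma.snd _ _))

instance (n : ℕ) : PreservesColimitsOfSize.{u, u} (genVar.{u} n) :=
  have : PreservesColimitsOfSize.{u, u} (Comma.fst (𝟭 (Type u)) (sphVar.{u} n)) := ⟨inferInstance⟩
  inferInstanceAs (PreservesColimitsOfSize.{u, u} (toComma n ⋙ Comma.fst _ _))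

theorem isIso_of_bijective_genMap {n : ℕ} {C D : CompVar.{u} (n + 1)} (σ : C ⟶ D)
    [IsIso ((downVar n).map σ)] (h : Function.Bijective (genMap σ)) : IsIso σ := by
  have hl : IsIso ((genVar n).map σ) := (isIso_iff_bijective _).2 h
  let l := asIso ((genVar n).map σ)
  let r := asIso ((downVar n).map σ)
  have : IsIso ((toComma n).map σ) := (Comma.isoMk (X := (toComma n).obj C)
    (Y := (toComma n).obj D) l r ((toComma n).map σ).w).isIso_hom
  exact isIso_of_reflects_iso σ (toComma n)

end Colimits

-- Corepresentability of spheres, cells and homomorphisms of given shape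

section Familial

theorem comp_bang {k : ℕ} {C D : CompVar.{u} k} (σ : C ⟶ D) :
    σ.hom ≫ bang k D.obj = bang k C.obj :=
  eq_bang k _ (genPres_comp k _ _ σ.property (genPres_bang k D.obj))

/-- The functor of elements of `F` of shape `x₀`. -/
def fiberVar {k : ℕ} (F : Comp.{u} k ⥤ Type u) (x₀ : F.obj (top k)) : CompVar.{u} k ⥤ Type u :=
  fiberFunctor (F := wideSubcategoryInclusion _ ⋙ F) (fun C a => F.map (bang k C.obj) a)
    (fun {_ D} f a => (F.map_comp_apply f.hom (bang k D.obj) a).symm.trans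
      (congrArg (fun g => F.map g a) (comp_bang f))) x₀

/-- A functor on computads is familial if the elements of each shape are corepresentable with
respect to generator-preserving homomorphisms. -/
def Familial {k : ℕ} (F : Comp.{u} k ⥤ Type u) : Prop :=
  ∀ x₀ : F.obj (top k), (fiberVar F x₀).IsCorepresentable

theorem familial_sph_zero : Familial (sph.{u} 0) := fun x₀ => by
  refine isCorepresentable_of_existsUnique (E := CompVar.{u} 0) ⟨(ULift.{u} Bool : Type u)⟩
    ⟨(⟨false⟩, ⟨true⟩), rfl⟩ fun D y => ?_
  obtain ⟨⟨a, b⟩, hy⟩ := y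
  refine ⟨⟨TypeCat.ofHom fun i : ULift.{u} Bool => cond i.down b a, trivial⟩, rfl, fun f hf => ?_⟩
  have h := congrArg Subtype.val hf
  refine WideSubcategory.hom_ext _ (TypeCat.homEquiv.injective (funext fun i => ?_))
  obtain ⟨_ | _⟩ := i
  · exact congrArg Prod.fst h
  · exact congrArg Prod.snd h

theorem familial_cell_zero : Familial (cell.{u} 0) := fun x₀ => by
  refine isCorepresentable_of_existsUnique (E := CompVar.{u} 0) ⟨(PUnit.{u + 1} : Type u)⟩
    ⟨PUnit.unit, rfl⟩ fun D y => ?_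
  obtain ⟨a, hy⟩ := y
  refine ⟨⟨TypeCat.ofHom fun _ : PUnit.{u + 1} => a, trivial⟩, rfl, fun f hf => ?_⟩
  exact WideSubcategory.hom_ext _ (TypeCat.homEquiv.injective
    (funext fun _ => congrArg Subtype.val hf))

theorem familial_coyoneda_zero (D : Comp.{u} 0) : Familial (coyoneda.obj (op D)) := fun x₀ => by
  refine isCorepresentable_of_existsUnique (E := CompVar.{u} 0) ⟨D⟩
    ⟨𝟙 D, TypeCat.homEquiv.injective rfl⟩ fun C y => ?_
  refine ⟨⟨y.1, trivial⟩, Subtype.ext (Category.id_comp y.1), fun f hf => ?_⟩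
  exact WideSubcategory.hom_ext _ ((Category.id_comp f.hom).symm.trans (congrArg Subtype.val hf))

variable {k : ℕ}

/-- The `k`-computad `C` as a `(k+1)`-computad without generators of dimension `k + 1`. -/
def noGen (C : CompVar.{u} k) : CompVar.{u} (k + 1) :=
  ⟨({ base := C.obj, Gen := PEmpty, bdry := PEmpty.elim } : Computad (stage.{u} k))⟩

theorem bijective_downVar_map {C D : CompVar.{u} (k + 1)}
    [IsEmpty (Computad.Gen (S := stage.{u} k) C.obj)] :
    Function.Bijective fun f : C ⟶ D => (downVar k).map f :=
  ⟨fun _ _ h => compVar_hom_ext h (funext isEmptyElim),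
    fun f => ⟨homMk f isEmptyElim isEmptyElim, rfl⟩⟩

instance (C : CompVar.{u} k) : IsEmpty (Computad.Gen (S := stage.{u} k) (noGen C).obj) :=
  inferInstanceAs (IsEmpty PEmpty)

/-- `noGen` is left adjoint to `downVar`, so it carries a corepresenting object of `F` to one of the
composite. -/
instance isCorepresentable_downVar_comp (F : CompVar.{u} k ⥤ Type u) [F.IsCorepresentable] :
    (downVar k ⋙ F).IsCorepresentable := by
  obtain ⟨R, r, h⟩ := exists_universal_element F
  refine isCorepresentable_of_existsUnique (noGen R) r fun D y => ?_
  obtain ⟨f, hf, f_uniq⟩ := h _ y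
  obtain ⟨inj, surj⟩ := bijective_downVar_map (C := noGen R) (D := D)
  obtain ⟨g, hg⟩ := surj f
  exact ⟨g, (congrArg (fun f => F.map f r) hg).trans hf,
    fun g' hg' => inj ((f_uniq _ hg').trans hg.symm)⟩

/-- Homomorphisms out of a computad are familial when they are so in lower dimensions and the cells
which are values on generators are so. -/
theorem isCorepresentable_fiberVar_coyoneda (hsph : Familial (sph.{u} k))
    {D : Comp.{u} (k + 1)}
    (hD : Familial (coyoneda.obj (op ((down k).obj D)))) (τ₀ : D ⟶ top (k + 1))
    (hcell : ∀ v, (fiberVar (cell (k + 1)) (Hom.onGen (S := stage.{u} k) τ₀ v)).IsCorepresentable) :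
    (fiberVar (coyoneda.obj (op D)) τ₀).IsCorepresentable := by
  have h₁ := hD ((down k).map τ₀)
  have h₂ := fun v => hsph (Hom.onGen (S := stage.{u} k) τ₀ v).bdry
  -- A homomorphism out of `D` is a lower-dimensional part and, for each generator `v`, a cell,
  -- matched over the spheres: the image of the boundary of `v` must be the boundary of that cell.
  refine isCorepresentable_of_pullback
    (I := Computad.Gen (S := stage.{u} k) D)
    (A := downVar k ⋙ fiberVar (coyoneda.obj (op ((down k).obj D))) ((down k).map τ₀))
    (B := fun v => fiberVar (cell (k + 1)) (Hom.onGen (S := stage.{u} k) τ₀ v))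
    (S := fun v => downVar k ⋙ fiberVar (sph k) (Hom.onGen (S := stage.{u} k) τ₀ v).bdry)
    (π :=
      { app := fun C => TypeCat.ofHom fun τ =>
          ⟨(down k).map τ.1, congrArg (fun f => (down k).map f) τ.2⟩
        naturality := fun _ _ _ => rfl })
    (ρ := fun v =>
      { app := fun C => TypeCat.ofHom fun τ =>
          ⟨Hom.onGen (S := stage.{u} k) τ.1 v,
            congrArg (fun f => Hom.onGen (S := stage.{u} k) f v) τ.2⟩
        naturality := fun _ _ _ => rfl })
    (α := fun v =>
      { app := fun C => TypeCat.ofHom fun τ =>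
          ⟨(sph k).map τ.1 (Computad.bdry (S := stage.{u} k) D v),
            ((sph k).map_comp_apply τ.1 (bang k ((downVar k).obj C).obj) _).symm.trans
              ((congrArg (fun f => (sph k).map f _) τ.2).trans
                (Hom.comm (S := stage.{u} k) τ₀ v).symm)⟩
        naturality := fun _ _ f => by
          ext τ
          exact Subtype.ext ((sph k).map_comp_apply τ.1 ((downVar k).map f).hom _) })
    (β := fun v =>
      { app := fun C => TypeCat.ofHom fun c =>
          ⟨Cell.bdry (S := stage.{u} k) c.1,
            (Cell.bdry_map (S := stage.{u} k) (bang (k + 1) C.obj) c.1).symm.trans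
              (congrArg Cell.bdry c.2)⟩
        naturality := fun _ _ f => by
          ext c
          exact Subtype.ext (Cell.bdry_map (S := stage.{u} k) f.hom c.1) })
    inferInstance hcell inferInstance (fun v C τ => Subtype.ext ?_) (fun C a b hab => ?_)
  · exact (Hom.comm (S := stage.{u} k) τ.1 v).symm
  · let τ : Hom (S := stage.{u} k) D C.obj :=
      { base := a.1
        onGen := fun v => (b v).1
        comm := fun v => (congrArg Subtype.val (hab v)).symm }
    refine ⟨⟨τ, ?_⟩, ⟨rfl, fun _ => rfl⟩, fun τ' hτ' => Subtype.ext ?_⟩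
    · exact Hom.ext (S := stage.{u} k) a.2 (funext fun v => (b v).2)
    · exact Hom.ext (S := stage.{u} k) (congrArg Subtype.val hτ'.1)
        (funext fun v => congrArg Subtype.val (hτ'.2 v))

theorem PreCell.coh_ne_var {n : ℕ} {S : Stage.{u} n} {C : Computad S} {B : Bat}
    {hB : B.dim ≤ n + 1} {A : S.Sph.obj (S.free B.pos)} {hA : S.Full B A}
    {τ : S.free B.pos ⟶ C.base} {τV : Pos.{u} B (n + 1) → PreCell C} {v : C.Gen} :
    PreCell.coh B hB A hA τ τV ≠ PreCell.var v :=
  nofun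

/-- The corepresenting object is the universal sphere of shape `A₀` with one generator attached
along it. -/
theorem isCorepresentable_fiberVar_var (hsph : Familial (sph.{u} k))
    (A₀ : (sph.{u} k).obj (top k)) :
    (fiberVar (cell (k + 1))
      (Cell.var (C := (top (k + 1) : Computad (stage.{u} k))) A₀)).IsCorepresentable := by
  have := hsph A₀
  obtain ⟨R, r, h⟩ := exists_universal_element (fiberVar (sph k) A₀)
  let J : Computad (stage.{u} k) := { base := R.obj, Gen := PUnit, bdry := fun _ => r.1 }
  refine isCorepresentable_of_existsUnique (E := CompVar.{u} (k + 1)) ⟨J⟩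
    ⟨Cell.var (C := J) PUnit.unit, congrArg Cell.var r.2⟩ fun D y => ?_
  obtain ⟨⟨v | _, hc⟩, hy⟩ := y
  · obtain ⟨f, hf, f_uniq⟩ := h ((downVar k).obj D)
      ⟨Computad.bdry (S := stage.{u} k) D.obj v, Cell.var_injective hy⟩
    refine ⟨homMk (C := ⟨J⟩) f (fun _ => v) fun _ => (congrArg Subtype.val hf).symm,
      rfl, fun g hg => ?_⟩
    have hg' : Hom.onGen (S := stage.{u} k) g.hom PUnit.unit = Cell.var v :=
      congrArg Subtype.val hg
    refine compVar_hom_ext (f_uniq _ (Subtype.ext ?_)) (funext fun _ => ?_)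
    · exact (Hom.comm (S := stage.{u} k) g.hom PUnit.unit).symm.trans (congrArg Cell.bdry hg')
    · exact Cell.var_injective ((var_genMap g PUnit.unit).trans
        (hg'.trans (congrArg Cell.var (congrFun (genMap_homMk (C := ⟨J⟩) (D := D) f (fun _ => v)
          fun _ => (congrArg Subtype.val hf).symm) PUnit.unit).symm)))
  · exact (PreCell.coh_ne_var (congrArg Subtype.val hy)).elim

/-- Substituting generators for generators keeps the outermost constructor, tree and full sphere of
a cell. Only the homomorphism inside can change, and it changes by composition. -/
theorem exists_eq_coh_of_map_eq {n : ℕ} {S : Stage.{u} n} {C D : Computad S} (σ : Hom C D)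
    (hσ : ∀ v, ∃ w, σ.onGen v = Cell.var w) (c : Cell C) {B : Bat}
    {hB : B.dim ≤ n + 1} {A : S.Sph.obj (S.free B.pos)} {hA : S.Full B A}
    {τ₀ : Hom (Computad.free S B.pos) D} (hc : c.map σ = Cell.coh B hB A hA τ₀) :
    ∃ τ : Hom (Computad.free S B.pos) C, c = Cell.coh B hB A hA τ ∧ τ.comp σ = τ₀ := by
  obtain ⟨v | ⟨B', hB', A', hA', τ, τV⟩, hc'⟩ := c
  · obtain ⟨w, hw⟩ := hσ v
    exact (PreCell.coh_ne_var (congrArg Subtype.val (hc.symm.trans hw))).elim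
  have h : PreCell.coh B' hB' A' hA' (τ ≫ σ.base) (fun p => (τV p).map σ) =
    PreCell.coh B hB A hA τ₀.base (fun p => (τ₀.onGen p).1) := congrArg Subtype.val hc
  injection h with h₁ h₂ h₃ h₄
  subst h₁
  obtain rfl := eq_of_heq h₂
  refine ⟨⟨τ, fun p => ⟨τV p, (hc' p).1⟩, fun p => (hc' p).2⟩, rfl, Hom.ext ?_ ?_⟩
  · exact eq_of_heq h₃
  · exact funext fun p => Subtype.ext (congrFun (eq_of_heq h₄) p)

theorem Cell.coh_injective {n : ℕ} {S : Stage.{u} n} {C : Computad S} {B : Bat}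
    {hB : B.dim ≤ n + 1} {A : S.Sph.obj (S.free B.pos)} {hA : S.Full B A} :
    Function.Injective (Cell.coh (C := C) B hB A hA) := fun τ τ' h => by
  have h : PreCell.coh B hB A hA τ.base (fun p => (τ.onGen p).1) =
    PreCell.coh B hB A hA τ'.base (fun p => (τ'.onGen p).1) := congrArg Subtype.val h
  injection h with _ _ h₃ h₄
  exact Hom.ext h₃ (funext fun p => Subtype.ext (congrFun h₄ p))

/-- `Cell.coh B hB A hA` is a bijection between homomorphisms of shape `τ₀` and cells of this shape,
so both functors have the same corepresenting object. -/
theorem isCorepresentable_fiberVar_coh {B : Bat} {hB : B.dim ≤ k + 1}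
    {A : (stage.{u} k).Sph.obj ((stage.{u} k).free B.pos)} {hA : (stage.{u} k).Full B A}
    (τ₀ : Hom (Computad.free (stage.{u} k) B.pos) (top (k + 1)))
    (h : (fiberVar (coyoneda.obj (op (show Comp.{u} (k + 1) from
      Computad.free (stage.{u} k) B.pos))) τ₀).IsCorepresentable) :
    (fiberVar (cell (k + 1)) (Cell.coh B hB A hA τ₀)).IsCorepresentable := by
  obtain ⟨R, r, h⟩ := exists_universal_element (fiberVar (coyoneda.obj (op
    (show Comp.{u} (k + 1) from Computad.free (stage.{u} k) B.pos))) τ₀)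
  refine isCorepresentable_of_existsUnique R
    ⟨Cell.coh (S := stage.{u} k) (C := R.obj) B hB A hA r.1, congrArg (Cell.coh B hB A hA) r.2⟩
    fun D y => ?_
  obtain ⟨τ, hy, hτ⟩ := exists_eq_coh_of_map_eq (S := stage.{u} k) (bang (k + 1) D.obj)
    (genPres_bang (k + 1) D.obj).2 y.1 y.2
  obtain ⟨f, hf, f_uniq⟩ := h D ⟨τ, hτ⟩
  refine ⟨f, Subtype.ext ?_, fun g hg => f_uniq g (Subtype.ext ?_)⟩
  · exact (congrArg (Cell.coh (S := stage.{u} k) (C := D.obj) B hB A hA)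
      (congrArg Subtype.val hf)).trans hy.symm
  · exact Cell.coh_injective (S := stage.{u} k) (C := D.obj) ((congrArg Subtype.val hg).trans hy)

/-- Structural induction on the shape: the shapes `τV p` are smaller, and the lower part of `τ₀` is
covered by `hhom` one dimension down. -/
theorem familial_cell_succ (hsph : Familial (sph.{u} k))
    (hhom : ∀ D : Comp.{u} k, Familial (coyoneda.obj (op D))) : Familial (cell.{u} (k + 1)) := by
  suffices h : ∀ (c₀ : PreCell (S := stage.{u} k) (top (k + 1))) (hc₀ : c₀.IsCell),
      (fiberVar (cell (k + 1))
        (⟨c₀, hc₀⟩ : Cell (S := stage.{u} k) (top (k + 1)))).IsCorepresentable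
    from fun c₀ => h c₀.1 c₀.2
  intro c₀
  induction c₀ with
  | var A₀ => exact fun _ => isCorepresentable_fiberVar_var hsph A₀
  | coh B hB A hA τ τV ih =>
    intro hc₀
    let τ₀ : Hom (Computad.free (stage.{u} k) B.pos) (top (k + 1)) :=
      ⟨τ, fun p => ⟨τV p, (hc₀ p).1⟩, fun p => (hc₀ p).2⟩
    exact isCorepresentable_fiberVar_coh τ₀
      (isCorepresentable_fiberVar_coyoneda hsph (hhom _) τ₀ fun p => ih p _)

theorem familial_coyoneda_succ (hsph : Familial (sph.{u} k))
    (hhom : ∀ D : Comp.{u} k, Familial (coyoneda.obj (op D))) (D : Comp.{u} (k + 1)) :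
    Familial (coyoneda.obj (op D)) := fun τ₀ =>
  isCorepresentable_fiberVar_coyoneda hsph (hhom _) τ₀ fun _ => familial_cell_succ hsph hhom _

/-- The two cells of a sphere. -/
def Sphere.side {n : ℕ} {S : Stage.{u} n} {C : Computad S} (A : Sphere C) : Bool → Cell C
  | false => A.fst
  | true => A.snd

theorem Sphere.side_bdry {n : ℕ} {S : Stage.{u} n} {C : Computad S} (A : Sphere C) :
    ∀ b, (A.side b).bdry = A.base
  | false => A.fst_bdry
  | true => A.snd_bdry

theorem Sphere.side_map {n : ℕ} {S : Stage.{u} n} {C D : Computad S} (σ : Hom C D) (A : Sphere C) :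
    ∀ b, (A.map σ).side b = (A.side b).map σ
  | false => rfl
  | true => rfl

theorem familial_sph_succ (hsph : Familial (sph.{u} k)) (hcell : Familial (cell.{u} (k + 1))) :
    Familial (sph.{u} (k + 1)) := fun A₀ => by
  have h₀ := hsph (Sphere.base (S := stage.{u} k) A₀)
  -- A sphere is a base and two cells, each with that base as its boundary. The base already is an
  -- element of the functor over which the pullback is taken, so `α` is the identity.
  refine isCorepresentable_of_pullback (I := ULift.{u} Bool)
    (A := downVar k ⋙ fiberVar (sph k) (Sphere.base (S := stage.{u} k) A₀))
    (B := fun b => fiberVar (cell (k + 1)) (Sphere.side (S := stage.{u} k) A₀ b.down))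
    (S := fun _ => downVar k ⋙ fiberVar (sph k) (Sphere.base (S := stage.{u} k) A₀))
    (π :=
      { app := fun C => TypeCat.ofHom fun A =>
          ⟨Sphere.base (S := stage.{u} k) A.1,
            congrArg (Sphere.base (S := stage.{u} k)) A.2⟩
        naturality := fun _ _ _ => rfl })
    (ρ := fun b =>
      { app := fun C => TypeCat.ofHom fun A =>
          ⟨Sphere.side (S := stage.{u} k) A.1 b.down, (Sphere.side_map (S := stage.{u} k)
            (bang (k + 1) C.obj) A.1 b.down).symm.trans
              (congrArg (fun A => Sphere.side (S := stage.{u} k) A b.down) A.2)⟩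
        naturality := fun _ _ f => by
          ext A
          exact Subtype.ext (Sphere.side_map (S := stage.{u} k) f.hom A.1 b.down) })
    (α := fun _ => 𝟙 _)
    (β := fun b =>
      { app := fun C => TypeCat.ofHom fun c =>
          ⟨Cell.bdry (S := stage.{u} k) c.1,
            (Cell.bdry_map (S := stage.{u} k) (bang (k + 1) C.obj) c.1).symm.trans
              ((congrArg Cell.bdry c.2).trans (Sphere.side_bdry (S := stage.{u} k) A₀ b.down))⟩
        naturality := fun _ _ f => by
          ext c
          exact Subtype.ext (Cell.bdry_map (S := stage.{u} k) f.hom c.1) })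
    inferInstance (fun _ => hcell _) inferInstance (fun b C A => Subtype.ext ?_)
    (fun C a b hab => ?_)
  · exact (Sphere.side_bdry (S := stage.{u} k) A.1 b.down).symm
  · let A : Sphere (S := stage.{u} k) C.obj :=
      { base := a.1
        fst := (b ⟨false⟩).1
        snd := (b ⟨true⟩).1
        fst_bdry := (congrArg Subtype.val (hab ⟨false⟩)).symm
        snd_bdry := (congrArg Subtype.val (hab ⟨true⟩)).symm }
    have hA : ∀ i : ULift.{u} Bool, A.side i.down = (b i).1 := by rintro ⟨_ | _⟩ <;> rfl
    refine ⟨⟨A, ?_⟩, ⟨rfl, fun i => Subtype.ext (hA i)⟩, fun A' hA' => Subtype.ext ?_⟩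
    · exact Sphere.ext (S := stage.{u} k) a.2 (b ⟨false⟩).2 (b ⟨true⟩).2
    · exact Sphere.ext (S := stage.{u} k) (congrArg Subtype.val hA'.1)
        (congrArg Subtype.val (hA'.2 ⟨false⟩)) (congrArg Subtype.val (hA'.2 ⟨true⟩))

/-- Both statements are proved together, since cells in dimension `k + 1` use spheres and
homomorphisms in dimension `k`, and in turn give those in dimension `k + 1`. -/
theorem familial_sph_coyoneda : ∀ k : ℕ, Familial (sph.{u} k) ∧
    ∀ D : Comp.{u} k, Familial (coyoneda.obj (op D))
  | 0 => ⟨familial_sph_zero, familial_coyoneda_zero⟩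
  | k + 1 => by
    obtain ⟨h₁, h₂⟩ := familial_sph_coyoneda k
    exact ⟨familial_sph_succ h₁ (familial_cell_succ h₁ h₂), familial_coyoneda_succ h₁ h₂⟩

theorem familial_cell : ∀ k : ℕ, Familial (cell.{u} k)
  | 0 => familial_cell_zero
  | k + 1 => familial_cell_succ (familial_sph_coyoneda k).1 (familial_sph_coyoneda k).2

instance (k : ℕ) (c₀ : (cell.{u} k).obj (top k)) : (cellOfShape k c₀).IsCorepresentable :=
  familial_cell k c₀

end Familial

-- Generator shapes and the equivalence for finite `n`

section Shapes

theorem nonempty_corepresentableBy_reprObj {E : Type (u + 1)} [Category.{u} E] [Nonempty E]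
    (F : E ⥤ Type u) [F.IsCorepresentable] : Nonempty (F.CorepresentableBy (reprObj F)) :=
  Classical.epsilon_spec (p := fun X => Nonempty (F.CorepresentableBy X))
    ⟨F.coreprX, ⟨F.corepresentableBy⟩⟩

/-- A cocomplete category with a small, jointly conservative family of corepresentable functors
preserving colimits is the category of presheaves on the corepresenting objects. -/
theorem nonempty_equivalence_presheaf_of_corepresentableBy {E : Type (u + 1)} [Category.{u} E]
    [HasColimitsOfSize.{u, u} E] {ι : Type u} (X : ι → E) (Φ : ι → E ⥤ Type u)
    (hX : ∀ i, Nonempty ((Φ i).CorepresentableBy (X i)))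
    (hΦ : ∀ i, PreservesColimitsOfSize.{u, u} (Φ i))
    (conservative : ∀ {A B : E} (f : A ⟶ B),
      (∀ i, Function.Bijective ((Φ i).map f)) → IsIso f) :
    Nonempty (E ≌ ((ObjectProperty.ofObj X).FullSubcategoryᵒᵖ ⥤ Type u)) := by
  refine nonempty_equivalence_presheaf X (fun i => ?_) fun f h => conservative f fun i => ?_
  · exact preservesColimits_of_natIso (hX i).some.toIso.symm
  · let e := (hX i).some
    have he : (Φ i).map f ∘ e.homEquiv = e.homEquiv ∘ fun g => g ≫ f :=
      funext fun g => (e.homEquiv_comp f g).symm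
    rw [← Function.Bijective.of_comp_iff _ e.homEquiv.bijective, he]
    exact e.homEquiv.bijective.comp (h i)

theorem bijective_map_of_bijective_fiberFunctor {E : Type*} [Category.{u} E] {F : E ⥤ Type u}
    {X : Type u} (t : ∀ C : E, F.obj C → X)
    (ht : ∀ {C D : E} (f : C ⟶ D) (a : F.obj C), t D (F.map f a) = t C a) {C D : E} (f : C ⟶ D)
    (h : ∀ x, Function.Bijective ((fiberFunctor t ht x).map f)) : Function.Bijective (F.map f) := by
  refine ⟨fun a b hab => ?_, fun b => ?_⟩
  · have hb : t C b = t C a := by rw [← ht f, ← ht f a, hab]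
    exact congrArg Subtype.val
      ((h (t C a)).1 (a₁ := ⟨a, rfl⟩) (a₂ := ⟨b, hb⟩) (Subtype.ext hab))
  · obtain ⟨a, ha⟩ := (h (t D b)).2 ⟨b, rfl⟩
    exact ⟨a.1, congrArg Subtype.val ha⟩

/-- The shape of a generator. -/
def genShape {k : ℕ} (C : CompVar.{u} (k + 1)) (v : (genVar k).obj C) : TopSphere.{u} (k + 1) :=
  (sph k).map (bang k ((downVar k).obj C).obj) (Computad.bdry (S := stage.{u} k) C.obj v)

theorem genShape_map {k : ℕ} {C D : CompVar.{u} (k + 1)} (σ : C ⟶ D) (v : (genVar k).obj C) :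
    genShape D ((genVar k).map σ v) = genShape C v :=
  (congrArg ((sph k).map _) (bdry_genMap σ v)).trans
    (((sph k).map_comp_apply _ _ _).symm.trans
      (congrArg (fun f => (sph k).map f _) (comp_bang ((downVar k).map σ))))

/-- The cells having the shape of a generator of the terminal computad are the generators. -/
noncomputable def genShapeIso {k : ℕ} (A₀ : TopSphere.{u} (k + 1)) :
    fiberFunctor (F := genVar k) genShape genShape_map A₀ ≅
      cellOfShape (k + 1) (varTop (k + 1) A₀) :=
  NatIso.ofComponents (fun _ => Equiv.toIso (Equiv.ofBijective
    (fun v => ⟨Cell.var (S := stage.{u} k) v.1, congrArg Cell.var v.2⟩)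
    ⟨fun v w h => Subtype.ext (Cell.var_injective (congrArg Subtype.val h)), by
      rintro ⟨⟨v | _, hc⟩, hy⟩
      · exact ⟨⟨v, Cell.var_injective hy⟩, rfl⟩
      · exact (PreCell.coh_ne_var (congrArg Subtype.val hy)).elim⟩))
    fun {C D} σ => by
      ext v
      exact Subtype.ext (var_genMap σ v.1)

instance (c₀ : (cell.{u} 0).obj (top 0)) : PreservesColimitsOfSize.{u, u} (cellOfShape 0 c₀) :=
  preservesColimits_of_natIso (F := wideSubcategoryInclusion (genPres.{u} 0))
    (NatIso.ofComponents (fun _ => Equiv.toIso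
      { toFun := fun c => ⟨c, rfl⟩
        invFun := fun c => c.1
        left_inv := fun _ => rfl
        right_inv := fun _ => rfl }) fun _ => rfl)

/-- In positive dimension this is a fibre of the generator functor, so generator shapes, unlike
arbitrary ones, need no analysis of coherence cells. -/
theorem preservesColimits_cellOfShape_varTop : ∀ (k : ℕ) (A₀ : TopSphere.{u} k),
    PreservesColimitsOfSize.{u, u} (cellOfShape k (varTop k A₀))
  | 0, A₀ => inferInstance
  | k + 1, A₀ => by
    have := preservesColimits_fiberFunctor (F := genVar.{u} k) genShape genShape_map A₀
    exact preservesColimits_of_natIso (genShapeIso A₀)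

theorem isIso_of_bijective_cellOfShape_zero {C D : CompVar.{u} 0} (σ : C ⟶ D)
    (h : ∀ A₀, Function.Bijective ((cellOfShape 0 (varTop.{u} 0 A₀)).map σ)) : IsIso σ := by
  have : IsIso ((wideSubcategoryInclusion (genPres.{u} 0)).map σ) := by
    refine (isIso_iff_bijective _).2 ⟨fun a b hab => ?_, fun b => ?_⟩
    · exact congrArg Subtype.val
        ((h PUnit.unit).1 (a₁ := ⟨a, rfl⟩) (a₂ := ⟨b, rfl⟩) (Subtype.ext hab))
    · obtain ⟨a, ha⟩ := (h PUnit.unit).2 ⟨b, rfl⟩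
      exact ⟨a.1, congrArg Subtype.val ha⟩
  exact isIso_of_reflects_iso σ (wideSubcategoryInclusion _)

theorem isIso_of_bijective_cellOfShape_succ {k : ℕ} {C D : CompVar.{u} (k + 1)} (σ : C ⟶ D)
    [IsIso ((downVar k).map σ)]
    (h : ∀ A₀, Function.Bijective ((cellOfShape (k + 1) (varTop.{u} (k + 1) A₀)).map σ)) :
    IsIso σ := by
  refine isIso_of_bijective_genMap σ
    (bijective_map_of_bijective_fiberFunctor (F := genVar k) genShape genShape_map σ fun A₀ => ?_)
  refine (isIso_iff_bijective _).1 ?_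
  have := (isIso_iff_bijective _).2 (h A₀)
  exact (NatIso.isIso_map_iff (genShapeIso A₀) σ).2 this

theorem truncVar_self (k : ℕ) : truncVar.{u} (le_refl k) = 𝟭 (CompVar k) := Nat.leRecOn_self _

theorem truncVar_succ {k n : ℕ} (h : k ≤ n) :
    truncVar.{u} (h.trans n.le_succ) = downVar n ⋙ truncVar h :=
  Nat.leRecOn_succ h _

/-- `truncVar` is built by removing dimensions at the top; removing one more at the bottom requires
an induction on `n`. -/
theorem truncVar_comp_downVar {k n : ℕ} (h : k + 1 ≤ n) :
    truncVar.{u} h ⋙ downVar k = truncVar (k.le_succ.trans h) := by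
  induction n, h using Nat.le_induction with
  | base => rw [truncVar_self, truncVar_succ (le_refl k), truncVar_self]; rfl
  | succ n h ih =>
    rw [truncVar_succ h, truncVar_succ (k.le_succ.trans h), ← ih]; rfl

instance isCorepresentable_truncVar_comp {k n : ℕ} (h : k ≤ n) (F : CompVar.{u} k ⥤ Type u)
    [F.IsCorepresentable] : (truncVar h ⋙ F).IsCorepresentable := by
  induction n, h using Nat.le_induction with
  | base => rwa [truncVar_self]
  | succ n h ih =>
    rw [truncVar_succ h]
    exact inferInstanceAs (downVar n ⋙ truncVar h ⋙ F).IsCorepresentable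

instance preservesColimits_truncVar {k n : ℕ} (h : k ≤ n) :
    PreservesColimitsOfSize.{u, u} (truncVar.{u} h) := by
  induction n, h using Nat.le_induction with
  | base => rw [truncVar_self]; infer_instance
  | succ n h ih => rw [truncVar_succ h]; infer_instance

/-- Once the truncation to dimension `j` is invertible, bijectivity on generators of every shape in
dimension `j + 1` makes the next truncation invertible. -/
theorem isIso_truncVar_map {n : ℕ} {C D : CompVar.{u} n} (σ : C ⟶ D)
    (h : ∀ (j : ℕ) (hj : j ≤ n) (A₀ : TopSphere.{u} j),
      Function.Bijective ((cellShape hj (varTop j A₀)).map σ)) :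
    ∀ (j : ℕ) (hj : j ≤ n), IsIso ((truncVar hj).map σ)
  | 0, hj => isIso_of_bijective_cellOfShape_zero _ (h 0 hj)
  | j + 1, hj => by
    have := isIso_truncVar_map σ h j (j.le_succ.trans hj)
    rw [← truncVar_comp_downVar hj] at this
    have : IsIso ((downVar j).map ((truncVar hj).map σ)) := this
    exact isIso_of_bijective_cellOfShape_succ _ (h (j + 1) hj)

theorem nonempty_corepresentableBy_J {j n : ℕ} (h : j ≤ n) (c₀ : (cell.{u} j).obj (top j)) :
    Nonempty ((cellShape h c₀).CorepresentableBy (J h c₀)) :=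
  have : (cellShape h c₀).IsCorepresentable := isCorepresentable_truncVar_comp h _
  nonempty_corepresentableBy_reprObj _

theorem nonempty_compVar_equivalence (n : ℕ) :
    Nonempty (CompVar.{u} n ≌ ((V.{u} n)ᵒᵖ ⥤ Type u)) := by
  refine nonempty_equivalence_presheaf_of_corepresentableBy _
    (fun i : (Σ j : Fin (n + 1), TopSphere.{u} j) =>
      cellShape (Nat.le_of_lt_succ i.1.2) (varTop i.1 i.2))
    (fun i => nonempty_corepresentableBy_J _ _) (fun i => ?_) fun σ h => ?_
  · have := preservesColimits_cellOfShape_varTop i.1 i.2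
    exact inferInstanceAs (PreservesColimitsOfSize.{u, u} (truncVar _ ⋙ cellOfShape _ _))
  · have := isIso_truncVar_map σ (fun j hj A₀ => h ⟨⟨j, Nat.lt_succ_of_le hj⟩, A₀⟩) n le_rfl
    rw [truncVar_self] at this
    exact this

end Shapes

-- Compatible sequences in a tower

section Sequences

/-- Below `k` the terms are forced by `δ`, and from `k` on they are produced by the sections.
Induction on `k` shifts the tower by one and restores the missing term as `δ 0 (s 0)`. -/
theorem exists_sequence_of_sections {H : ℕ → Type*} (δ : ∀ n, H (n + 1) → H n)
    (σ : ∀ n, H n → H (n + 1)) (hσ : ∀ n x, δ n (σ n x) = x) (k : ℕ) (x : H k) :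
    ∃ s : ∀ n, H n,
      (∀ n, δ n (s (n + 1)) = s n) ∧ s k = x ∧ ∀ n, k ≤ n → s (n + 1) = σ n (s n) := by
  induction k generalizing H with
  | zero =>
    exact ⟨fun n => Nat.rec x (fun n y => σ n y) n, fun n => hσ n _, rfl, fun _ _ => rfl⟩
  | succ k ih =>
    obtain ⟨s, h₁, h₂, h₃⟩ := ih (H := fun n => H (n + 1)) (fun n => δ (n + 1))
      (fun n => σ (n + 1)) (fun n => hσ (n + 1)) x
    refine ⟨fun n => Nat.casesOn n (δ 0 (s 0)) s, ?_, h₂, ?_⟩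
    · rintro (_ | n)
      · rfl
      · exact h₁ n
    · rintro (_ | n) h
      · omega
      · exact h₃ n (by omega)

theorem existsUnique_sequence_of_bijective {H : ℕ → Type*} (δ : ∀ n, H (n + 1) → H n) (k : ℕ)
    (hδ : ∀ n, k ≤ n → Function.Bijective (δ n)) (x : H k) :
    ∃! s : ∀ n, H n, (∀ n, δ n (s (n + 1)) = s n) ∧ s k = x := by
  induction k generalizing H with
  | zero =>
    choose inj surj using fun n => hδ n n.zero_le
    choose σ hσ using surj
    obtain ⟨s, h₁, h₂, -⟩ := exists_sequence_of_sections δ σ hσ 0 x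
    refine ⟨s, ⟨h₁, h₂⟩, fun s' h' => funext fun n => ?_⟩
    induction n with
    | zero => exact h'.2.trans h₂.symm
    | succ n ih => exact inj n ((h'.1 n).trans (ih.trans (h₁ n).symm))
  | succ k ih =>
    obtain ⟨s, ⟨h₁, h₂⟩, h₃⟩ := ih (H := fun n => H (n + 1)) (fun n => δ (n + 1))
      (fun n hn => hδ (n + 1) (by omega)) x
    refine ⟨fun n => Nat.casesOn n (δ 0 (s 0)) s, ⟨?_, h₂⟩, fun s' h' => ?_⟩
    · rintro (_ | n)
      · rfl
      · exact h₁ n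
    · have h := h₃ (fun n => s' (n + 1)) ⟨fun n => h'.1 (n + 1), h'.2⟩
      subst h
      funext n
      cases n with
      | zero => exact (h'.1 0).symm
      | succ n => rfl

end Sequences

-- `ω`-computads

section Omega

theorem hom_eqToIso_mk {n : ℕ} {C D : Comp.{u} n} (h : C = D) :
    (eqToIso (congrArg (WideSubcategory.mk (_P := genPres.{u} n)) h)).hom.hom = eqToHom h := by
  subst h; rfl

/-- The forgetful functors out of `ω`-computads are compatible. -/
def truncVarOmegaIso (n : ℕ) : truncVarOmega.{u} (n + 1) ⋙ downVar n ≅ truncVarOmega n :=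
  NatIso.ofComponents (fun C => eqToIso (congrArg WideSubcategory.mk (C.obj.down_obj n)))
    fun {C D} σ => by
      refine WideSubcategory.hom_ext _ ?_
      refine (congrArg₂ (· ≫ ·) (CompOmega.Hom.down_app σ.hom n)
        (hom_eqToIso_mk (D.obj.down_obj n))).trans ?_
      refine Eq.trans ?_ (congrArg (· ≫ σ.hom.app n) (hom_eqToIso_mk (C.obj.down_obj n))).symm
      simp

theorem compVarOmega_hom_ext {C D : CompVarOmega.{u}} {σ ρ : C ⟶ D}
    (h : ∀ n, (truncVarOmega n).map σ = (truncVarOmega n).map ρ) : σ = ρ :=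
  WideSubcategory.hom_ext _ (CompOmega.Hom.ext
    (funext fun n => congrArg InducedWideCategory.Hom.hom (h n)))

/-- This replaces the transports along equalities of objects in the strict limit by the natural
isomorphism `truncVarOmegaIso`. -/
theorem exists_truncVarOmega_map_eq {C D : CompVarOmega.{u}}
    (f : ∀ n, (truncVarOmega n).obj C ⟶ (truncVarOmega n).obj D)
    (h : ∀ n, (downVar n).map (f (n + 1)) ≫ (truncVarOmegaIso n).hom.app D =
      (truncVarOmegaIso n).hom.app C ≫ f n) :
    ∃ σ : C ⟶ D, ∀ n, (truncVarOmega n).map σ = f n := by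
  refine ⟨⟨{ app := fun n => (f n).hom, down_app := fun n => ?_ }, fun n => (f n).property⟩,
    fun _ => rfl⟩
  have h' : (down n).map (f (n + 1)).hom ≫ eqToHom (D.obj.down_obj n) =
      eqToHom (C.obj.down_obj n) ≫ (f n).hom :=
    (congrArg (_ ≫ ·) (hom_eqToIso_mk (D.obj.down_obj n)).symm).trans
      ((congrArg InducedWideCategory.Hom.hom (h n)).trans
        (congrArg (· ≫ (f n).hom) (hom_eqToIso_mk (C.obj.down_obj n))))
  exact ((comp_eqToHom_iff _ _ _).1 h').trans (Category.assoc _ _ _)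

theorem truncVarOmegaIso_naturality {C D : CompVarOmega.{u}} (σ : C ⟶ D) (n : ℕ) :
    (downVar n).map ((truncVarOmega (n + 1)).map σ) ≫ (truncVarOmegaIso n).hom.app D =
      (truncVarOmegaIso n).hom.app C ≫ (truncVarOmega n).map σ :=
  (truncVarOmegaIso n).hom.naturality σ

theorem isIso_of_isIso_truncVarOmega_map {C D : CompVarOmega.{u}} (σ : C ⟶ D)
    (h : ∀ n, IsIso ((truncVarOmega n).map σ)) : IsIso σ := by
  obtain ⟨ρ, hρ⟩ := exists_truncVarOmega_map_eq (fun n => inv ((truncVarOmega n).map σ)) fun n => by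
    rw [IsIso.eq_comp_inv, Category.assoc, ← truncVarOmegaIso_naturality, Functor.map_inv,
      IsIso.inv_hom_id_assoc]
  refine ⟨ρ, compVarOmega_hom_ext fun n => ?_, compVarOmega_hom_ext fun n => ?_⟩ <;>
  simp [hρ]

/-- An `ω`-computad without generators of dimension greater than `k` corepresents the
homomorphisms out of its underlying `k`-computad. -/
theorem bijective_truncVarOmega_map {C D : CompVarOmega.{u}} (k : ℕ)
    (hC : ∀ n, k ≤ n → IsEmpty (Computad.Gen (S := stage.{u} n) (C.obj.obj (n + 1)))) :
    Function.Bijective fun σ : C ⟶ D => (truncVarOmega k).map σ := by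
  -- Morphisms of `ω`-computads are the compatible sequences for `δ`, and `δ n` is bijective for `n
  -- ≥ k` because there are no generators to map.
  let δ (n : ℕ) (f : (truncVarOmega (n + 1)).obj C ⟶ (truncVarOmega (n + 1)).obj D) :
      (truncVarOmega n).obj C ⟶ (truncVarOmega n).obj D :=
    (truncVarOmegaIso n).inv.app C ≫ (downVar n).map f ≫ (truncVarOmegaIso n).hom.app D
  have hδ (n : ℕ) (f) (g) : δ n f = g ↔ (downVar n).map f ≫ (truncVarOmegaIso n).hom.app D =
      (truncVarOmegaIso n).hom.app C ≫ g :=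
    ((truncVarOmegaIso n).app C).inv_comp_eq
  have bij (n : ℕ) (hn : k ≤ n) : Function.Bijective (δ n) := by
    have : IsEmpty (Computad.Gen (S := stage.{u} n) ((truncVarOmega (n + 1)).obj C).obj) := hC n hn
    exact (Iso.homCongr ((truncVarOmegaIso n).app C) ((truncVarOmegaIso n).app D)).bijective.comp
      (bijective_downVar_map (C := (truncVarOmega (n + 1)).obj C)
        (D := (truncVarOmega (n + 1)).obj D))
  have key := existsUnique_sequence_of_bijective
    (H := fun n => (truncVarOmega n).obj C ⟶ (truncVarOmega n).obj D) δ k bij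
  refine (Function.bijective_iff_existsUnique _).2 fun f => ?_
  obtain ⟨s, ⟨hs, hsk⟩, s_uniq⟩ := key f
  obtain ⟨σ, hσ⟩ := exists_truncVarOmega_map_eq s fun n => (hδ n _ _).1 (hs n)
  refine ⟨σ, (hσ k).trans hsk, fun ρ hρ => compVarOmega_hom_ext fun n => ?_⟩
  rw [hσ, ← s_uniq (fun n => (truncVarOmega n).map ρ)
    ⟨fun n => (hδ n _ _).2 (truncVarOmegaIso_naturality ρ n), hρ⟩]

instance isCorepresentable_truncVarOmega_comp (k : ℕ) (F : CompVar.{u} k ⥤ Type u)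
    [F.IsCorepresentable] : (truncVarOmega k ⋙ F).IsCorepresentable := by
  obtain ⟨⟨R⟩, r, h⟩ := exists_universal_element F
  -- Extend the universal `k`-computad by truncations below `k` and by `noGen` above; `noGen` is a
  -- strict section of `down`, so the tower commutes on the nose.
  obtain ⟨s, hs, rfl, hs'⟩ := exists_sequence_of_sections (H := fun n => Comp.{u} n)
    (fun n => (down n).obj) (fun n C => (noGen ⟨C⟩).obj) (fun _ _ => rfl) k R
  refine isCorepresentable_of_existsUnique (E := CompVarOmega.{u}) ⟨⟨s, hs⟩⟩ r fun D y => ?_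
  obtain ⟨f, hf, f_uniq⟩ := h _ y
  obtain ⟨inj, surj⟩ := bijective_truncVarOmega_map (C := ⟨⟨s, hs⟩⟩) (D := D) k fun n hn => by
    change IsEmpty (Computad.Gen (s (n + 1)))
    rw [hs' n hn]
    exact inferInstanceAs (IsEmpty PEmpty)
  obtain ⟨g, hg⟩ := surj f
  exact ⟨g, (congrArg (fun f => F.map f r) hg).trans hf,
    fun g' hg' => inj ((f_uniq _ hg').trans hg.symm)⟩

/-- Lifting an isomorphism along the forgetful functor. -/
theorem exists_downVar_obj_eq {n : ℕ} {X : CompVar.{u} (n + 1)} {Y : CompVar.{u} n}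
    (i : Y ≅ (downVar n).obj X) :
    ∃ (Gen : Type u) (bdry : Gen → (sph n).obj Y.obj)
      (i' : (⟨({ base := Y.obj, Gen := Gen, bdry := bdry } : Computad (stage.{u} n))⟩ :
        CompVar.{u} (n + 1)) ≅ X), (downVar n).map i'.hom = i.hom := by
  -- Keep the generators and carry their boundaries back along `i`, so that the underlying computad
  -- is exactly `Y`.
  let bdry (v : (genVar n).obj X) := (sphVar n).map i.inv (Computad.bdry (S := stage.{u} n) X.obj v)
  let Y' : CompVar.{u} (n + 1) :=
    ⟨({ base := Y.obj, Gen := (genVar n).obj X, bdry := bdry } : Computad (stage.{u} n))⟩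
  let a : Y' ⟶ X := homMk (C := Y') i.hom id fun v =>
    (((sphVar n).map_comp_apply i.inv i.hom _).symm.trans
      ((congrArg (fun f : (downVar n).obj X ⟶ (downVar n).obj X =>
        (sphVar n).map f (Computad.bdry (S := stage.{u} n) X.obj v))
        i.inv_hom_id).trans ((sphVar n).map_id_apply _ _))).symm
  have ha : genMap a = id := genMap_homMk _ _ _
  have : IsIso ((downVar n).map a) := inferInstanceAs (IsIso i.hom)
  have : IsIso a := isIso_of_bijective_genMap a (ha ▸ Function.bijective_id)
  exact ⟨_, bdry, asIso a, rfl⟩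

/-- Isomorphisms lift along the forgetful functors, so a tower commuting up to isomorphism can be
replaced level by level with a strictly commuting one. -/
theorem exists_truncVarOmega_obj_iso (X : ∀ n, CompVar.{u} n)
    (e : ∀ n, (downVar n).obj (X (n + 1)) ≅ X n) :
    ∃ (Y : CompVarOmega.{u}) (y : ∀ n, (truncVarOmega n).obj Y ≅ X n), ∀ n,
      (downVar n).map (y (n + 1)).hom ≫ (e n).hom = (truncVarOmegaIso n).hom.app Y ≫ (y n).hom := by
  choose Gen bdry i hi using fun (n : ℕ) (y : Σ Y : CompVar.{u} n, Y ≅ X n) =>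
    exists_downVar_obj_eq (y.2 ≪≫ (e n).symm)
  let s : ∀ n, Σ Y : CompVar.{u} n, Y ≅ X n := fun n => Nat.rec ⟨X 0, Iso.refl _⟩
    (fun n y => ⟨_, i n y⟩) n
  let Y : CompVarOmega.{u} := ⟨{ obj := fun n => (s n).1.obj, down_obj := fun _ => rfl }⟩
  refine ⟨Y, fun n => (s n).2, fun n => ?_⟩
  have h := congrArg (· ≫ (e n).hom) (hi n (s n))
  exact h.trans ((Category.assoc _ _ _).trans ((congrArg (_ ≫ ·) (e n).inv_hom_id).trans
    ((Category.comp_id _).trans (Category.id_comp _).symm)))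

/-- The levelwise colimits form a tower up to isomorphism because `downVar` preserves colimits. Made
strict, this tower is a colimit at every level, and levelwise factorizations are compatible by
uniqueness. -/
theorem exists_isColimit_truncVarOmega {K : Type u} [Category.{u} K] (F : K ⥤ CompVarOmega.{u}) :
    ∃ c : Cocone F, Nonempty (IsColimit c) ∧
      ∀ n, Nonempty (IsColimit ((truncVarOmega n).mapCocone c)) := by
  let c (n : ℕ) := colimit.cocone (F ⋙ truncVarOmega n)
  let hc (n : ℕ) : IsColimit (c n) := colimit.isColimit _
  let hd (n : ℕ) : IsColimit ((downVar n).mapCocone (c (n + 1))) := isColimitOfPreserves _ (hc _)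
  let e (n : ℕ) : (downVar n).obj (c (n + 1)).pt ≅ (c n).pt :=
    (hd n).coconePointsIsoOfNatIso (hc n) (Functor.isoWhiskerLeft F (truncVarOmegaIso n))
  have he (n : ℕ) (k : K) : (downVar n).map ((c (n + 1)).ι.app k) ≫ (e n).hom =
      (truncVarOmegaIso n).hom.app (F.obj k) ≫ (c n).ι.app k :=
    IsColimit.comp_coconePointsIsoOfNatIso_hom (hd n) (hc n)
      (Functor.isoWhiskerLeft F (truncVarOmegaIso n)) k
  obtain ⟨Y, y, hy⟩ := exists_truncVarOmega_obj_iso (fun n => (c n).pt) e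
  have hy' (n : ℕ) : (downVar n).map (y (n + 1)).inv ≫ (truncVarOmegaIso n).hom.app Y =
      (e n).hom ≫ (y n).inv := by
    rw [Iso.eq_comp_inv, Category.assoc, ← hy, ← Functor.map_comp_assoc, Iso.inv_hom_id]
    exact (congrArg (· ≫ _) ((downVar n).map_id _)).trans (Category.id_comp _)
  choose ι hι using fun k => exists_truncVarOmega_map_eq (C := F.obj k) (D := Y)
    (fun n => (c n).ι.app k ≫ (y n).inv) fun n => by
      rw [Functor.map_comp, Category.assoc, hy' n]
      exact (Category.assoc _ _ _).symm.trans ((congrArg (· ≫ _) (he n k)).trans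
        (Category.assoc _ _ _))
  let cY : Cocone F :=
    { pt := Y
      ι :=
        { app := ι
          naturality := fun k l f => compVarOmega_hom_ext fun n => by
            have h := congrArg (· ≫ (y n).inv) ((c n).w f)
            rw [Functor.map_comp, Functor.map_comp, hι, hι]
            exact (Category.assoc _ _ _).symm.trans (h.trans (Category.comp_id _).symm) } }
  have hcY (n : ℕ) : IsColimit ((truncVarOmega n).mapCocone cY) :=
    (hc n).ofIsoColimit (Cocone.ext (y n).symm fun k => (hι k n).symm)
  refine ⟨cY, ⟨?_⟩, fun n => ⟨hcY n⟩⟩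
  choose d hd using fun s : Cocone F => exists_truncVarOmega_map_eq (C := Y) (D := s.pt)
    (fun n => (hcY n).desc ((truncVarOmega n).mapCocone s)) fun n => by
      refine (isColimitOfPreserves (downVar n) (hcY (n + 1))).hom_ext fun k => ?_
      have h₁ := congrArg (downVar n).map
        ((hcY (n + 1)).fac ((truncVarOmega (n + 1)).mapCocone s) k)
      have h₂ := (hcY n).fac ((truncVarOmega n).mapCocone s) k
      rw [Functor.map_comp] at h₁
      refine (Category.assoc _ _ _).symm.trans ((congrArg (· ≫ _) h₁).trans ?_)
      refine (truncVarOmegaIso_naturality (s.ι.app k) n).trans ?_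
      refine (congrArg (_ ≫ ·) h₂.symm).trans ((Category.assoc _ _ _).symm.trans ?_)
      refine (congrArg (· ≫ _) (truncVarOmegaIso_naturality (ι k) n).symm).trans ?_
      exact Category.assoc _ _ _
  exact
    { desc := d
      fac := fun s k => compVarOmega_hom_ext fun n => by
        rw [Functor.map_comp, hd]
        exact (hcY n).fac _ k
      uniq := fun s m hm => compVarOmega_hom_ext fun n => by
        rw [hd]
        exact (hcY n).uniq ((truncVarOmega n).mapCocone s) _ fun k =>
          ((truncVarOmega n).map_comp _ _).symm.trans (congrArg (truncVarOmega n).map (hm k)) }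

instance : HasColimitsOfSize.{u, u} CompVarOmega.{u} where
  has_colimits_of_shape _ _ :=
    ⟨fun F => by
      obtain ⟨c, ⟨hc⟩, -⟩ := exists_isColimit_truncVarOmega F
      exact ⟨⟨c, hc⟩⟩⟩

instance (n : ℕ) : PreservesColimitsOfSize.{u, u} (truncVarOmega.{u} n) where
  preservesColimitsOfShape :=
    ⟨fun {F} => by
      obtain ⟨c, ⟨hc⟩, h⟩ := exists_isColimit_truncVarOmega F
      exact preservesColimit_of_preserves_colimit_cocone hc (h n).some⟩

theorem isIso_truncVarOmega_map {C D : CompVarOmega.{u}} (σ : C ⟶ D)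
    (h : ∀ (j : ℕ) (A₀ : TopSphere.{u} j),
      Function.Bijective ((cellShapeOmega j (varTop j A₀)).map σ)) :
    ∀ j : ℕ, IsIso ((truncVarOmega j).map σ)
  | 0 => isIso_of_bijective_cellOfShape_zero _ (h 0)
  | j + 1 => by
    have := isIso_truncVarOmega_map σ h j
    have : IsIso ((downVar j).map ((truncVarOmega (j + 1)).map σ)) :=
      (NatIso.isIso_map_iff (truncVarOmegaIso j) σ).2 this
    exact isIso_of_bijective_cellOfShape_succ _ (h (j + 1))

theorem nonempty_corepresentableBy_JOmega (j : ℕ) (c₀ : (cell.{u} j).obj (top j)) :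
    Nonempty ((cellShapeOmega j c₀).CorepresentableBy (JOmega j c₀)) :=
  have : (cellShapeOmega j c₀).IsCorepresentable := isCorepresentable_truncVarOmega_comp j _
  nonempty_corepresentableBy_reprObj _

theorem nonempty_compVarOmega_equivalence :
    Nonempty (CompVarOmega.{u} ≌ (VOmega.{u}ᵒᵖ ⥤ Type u)) := by
  refine nonempty_equivalence_presheaf_of_corepresentableBy _
    (fun i : (Σ j : ℕ, TopSphere.{u} j) => cellShapeOmega i.1 (varTop i.1 i.2))
    (fun i => nonempty_corepresentableBy_JOmega _ _) (fun i => ?_) fun σ h =>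
      isIso_of_isIso_truncVarOmega_map σ (isIso_truncVarOmega_map σ fun j A₀ => h ⟨j, A₀⟩)
  have := preservesColimits_cellOfShape_varTop i.1 i.2
  exact inferInstanceAs (PreservesColimitsOfSize.{u, u} (truncVarOmega _ ⋙ cellOfShape _ _))

end Omega

end Computads

theorem mainTheorem1 :
    (∀ n : ℕ,
      (∀ (j : ℕ) (h : j ≤ n) (A₀ : Computads.TopSphere.{u} j),
        Nonempty ((Computads.cellShape h (Computads.varTop j A₀)).CorepresentableBy
          (Computads.J h (Computads.varTop j A₀)))) ∧
      Nonempty (Computads.CompVar.{u} n ≌ ((Computads.V.{u} n)ᵒᵖ ⥤ Type u))) ∧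
    ((∀ (j : ℕ) (A₀ : Computads.TopSphere.{u} j),
        Nonempty ((Computads.cellShapeOmega j (Computads.varTop j A₀)).CorepresentableBy
          (Computads.JOmega j (Computads.varTop j A₀)))) ∧
      Nonempty (Computads.CompVarOmega.{u} ≌ (Computads.VOmega.{u}ᵒᵖ ⥤ Type u))) :=
  ⟨fun n => ⟨fun _ h _ => Computads.nonempty_corepresentableBy_J h _,
      Computads.nonempty_compVar_equivalence n⟩,
    fun _ _ => Computads.nonempty_corepresentableBy_JOmega _ _,
    Computads.nonempty_compVarOmega_equivalence⟩
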